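/- Conventions. For a locally Lipschitz $f:\mathbb{R}^d\to\mathbb{R}$, $\partial f(x)$ is the Clarke subdifferential (the convex hull of all limits $\lim_i\nabla f(x_i)$ with $x_i\to x$ points of differentiability of $f$), and $\partial_\sigma f(x)=\mathrm{conv}\bigcup_{\|y-x\|\le\sigma}\partial f(y)$ is the Goldstein subdifferential. For $\mathcal M\subseteq\mathbb{R}^d$, $P_{\mathcal M}(x)$ is the nearest point of $\mathcal M$ to $x$. For a map $F$, $\mathrm{lip}_F(\bar x)=\limsup_{x,x'\to\bar x,\,x\ne x'}\|F(x)-F(x')\|/\|x-x'\|$ (operator norm if $F$ is matrix valued). $\mathcal M$ is a $C^p$ manifold around $\bar x$ if $\mathcal M\cap U=F^{-1}(0)$ for some open $U\ni\bar x$ and some $C^p$ map $F:U\to\mathbb{R}^m$ with surjective Jacobian; then $T_{\mathcal M}(y)=\ker\nabla F(y)$. Put $f_{\mathcal M}=f\circ P_{\mathcal M}$ and, for $y\in\mathcal M$ near $\bar x$, $\nabla_{\mathcal M}f(y)=\nabla f_{\mathcal M}(y)$ (the covariant gradient). Assumption A. $f:\mathbb{R}^d\to\mathbb{R}$ is locally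 Lipschitz, $\bar x$ is a local minimizer of $f$, and there are $\gamma>0$, $C_{(a)}>0$ and a set $\mathcal M\ni\bar x$ such that: (A1) $f(x)-f(\bar x)\ge\frac{\gamma}{2}\|x-\bar x\|^2$ for all $x$ near $\bar x$; (A2) $\mathcal M$ is an active $C^4$ manifold of $f$ around $\bar x$: $0\in\partial f(\bar x)$, $\mathcal M$ is a $C^4$ manifold around $\bar x$, $f|_{\mathcal M}$ agrees near $\bar x$ with a $C^4$ function defined on a neighborhood of $\bar x$, and for some neighborhood $U$ of $\bar x$, $\inf\{\|v\|: v\in\partial f(x),\ x\in U\setminus\mathcal M\}>0$; (A3) $\|P_{T_{\mathcal M}(y)}(v-\nabla_{\mathcal M}f(y))\|\le C_{(a)}\|x-y\|$ for all $x\in\mathbb{R}^d$ and $y\in\mathcal M$ near $\bar x$ and all $v\in\partial f(x)$; (A4) there is a function $o:\mathbb{R}\to\mathbb{R}$ with $\lim_{t\to0}o(t)/t=0$ such that $f(y)\ge f(x)+\langle v,y-x\rangle+o(\|y-x\|)$ for all $x\in\mathbb{R}^d$ and $y\in\mathcal M$ near $\bar x$ and all $v\in\partial f(x)$. Constants. Let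 $L=2\,\mathrm{lip}_f(\bar x)$, $\beta=2\,\mathrm{lip}_{\nabla f_{\mathcal M}}(\bar x)$, $C_{\mathcal M}=2\,\mathrm{lip}_{\nabla P_{\mathcal M}}(\bar x)$, $\mu=\frac14\liminf_{x\to\bar x,\,x\notin\mathcal M}\mathrm{dist}(0,\partial f(x))\in(0,\infty]$ ($\mu=\infty$ if $\mathcal M$ is a neighborhood of $\bar x$), $D_1=\frac{\mu}{8(\mu+L)}$ ($=\frac18$ if $\mu=\infty$), and for $\delta_{\mathrm A}>0$ let $$C_2=\min\Big\{\frac{\gamma}{8C_{(a)}},\frac{\min\{1,1/\delta_{\mathrm A}\}}{2}\Big\},\qquad \delta_{\mathrm{GI}}=\min\Big\{\frac{\delta_{\mathrm A}}{4},\frac{D_1}{C_{\mathcal M}}\Big\}$$ (with $D_1/0=\infty$). Theorem (Gradient inequality). Let Assumption A hold. Then there is $\delta_0>0$ such that for every $\delta_{\mathrm A}\in(0,\delta_0]$ the constants $D_1$, $C_2$, $\delta_{\mathrm{GI}}$ are positive and the following holds for all $a_1\in(0,D_1]$ and $a_2\in(0,C_2]$. Put $$\eta=\min\Big\{\frac{\gamma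 a_2}{8\max\{4La_2^2,\beta\}},\ \frac{\mu a_1}{4\max\{2L,\beta/a_2^2\}}\Big\},$$ with values in $[0,\infty]$ (a term is $\infty$ if its numerator is $\infty$ or its denominator is $0$); then $\eta>0$. For all $x$ with $\|x-\bar x\|<\delta_{\mathrm{GI}}$ and all $\sigma>0$, $$\sigma\,\mathrm{dist}(0,\partial_\sigma f(x))\ \ge\ \eta\,(f(x)-f(\bar x))$$ whenever $(x,\sigma)$ satisfies (1) or (2): (1) (normal region) $\frac{a_1}{2}\mathrm{dist}(x,\mathcal M)\le\sigma\le a_1\mathrm{dist}(x,\mathcal M)$ and $a_2^2\|P_{\mathcal M}(x)-\bar x\|^2\le\mathrm{dist}(x,\mathcal M)$; (2) (tangent region) $\frac{a_2}{2}\|P_{\mathcal M}(x)-\bar x\|\le\sigma\le a_2\|P_{\mathcal M}(x)-\bar x\|$ and $\frac{\mathrm{dist}(x,\mathcal M)}{\sigma}\le 2a_2\|P_{\mathcal M}(x)-\bar x\|$. Moreover, for every $x\ne\bar x$ with $\|x-\bar x\|<\delta_{\mathrm{GI}}$ there is $\sigma>0$ such that (1) or (2) holds. -/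

import Mathlib

open Filter Topology
open scoped ENNReal

noncomputable section

/-- The Euclidean space `ℝ^d` (inner product norm). -/
abbrev Vec (d : ℕ) : Type := EuclideanSpace ℝ (Fin d)

/-- Clarke subdifferential: the convex hull of all limits of gradients at points of
differentiability converging to `x`. -/
def clarkeSubdiff {d : ℕ} (f : Vec d → ℝ) (x : Vec d) : Set (Vec d) :=
  convexHull ℝ {v | ∃ u : ℕ → Vec d, (∀ i, DifferentiableAt ℝ f (u i)) ∧
    Tendsto u atTop (𝓝 x) ∧ Tendsto (fun i => gradient f (u i)) atTop (𝓝 v)}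

/-- Goldstein subdifferential: the convex hull of the union of the Clarke subdifferentials over the
closed ball of radius `σ` around `x`. -/
def goldsteinSubdiff {d : ℕ} (σ : ℝ) (f : Vec d → ℝ) (x : Vec d) : Set (Vec d) :=
  convexHull ℝ (⋃ y ∈ Metric.closedBall x σ, clarkeSubdiff f y)

/-- The set of nearest points of `M` to `x`. -/
def projSet {d : ℕ} (M : Set (Vec d)) (x : Vec d) : Set (Vec d) :=
  {y | y ∈ M ∧ ∀ z ∈ M, ‖y - x‖ ≤ ‖z - x‖}

/-- The projection map onto `M`: a nearest point of `M` to `x` (it is the unique one at every `x`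
close to a point around which `M` is a `C^2` manifold). -/
def proj {d : ℕ} (M : Set (Vec d)) (x : Vec d) : Vec d :=
  Classical.epsilon (fun y => y ∈ projSet M x)

/-- The Lipschitz modulus of `F` at `x₀`: the limit superior of `‖F x - F x'‖ / ‖x - x'‖` as
`x, x' → x₀`, `x ≠ x'`. -/
def lipAt {X Y : Type*} [PseudoEMetricSpace X] [PseudoEMetricSpace Y] (F : X → Y) (x₀ : X) :
    ℝ≥0∞ :=
  limsup (fun p : X × X => edist (F p.1) (F p.2) / edist p.1 p.2)
    (𝓝 (x₀, x₀) ⊓ 𝓟 {p | p.1 ≠ p.2})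

/-- A local description of `M` as a `C^p` manifold around `x₀`: a `C^p` map `F` on an open
neighbourhood `U` of `x₀` with surjective Jacobian and `M ∩ U = F⁻¹(0)`. -/
structure LocalDefiningMap {d : ℕ} (p : ℕ) (M : Set (Vec d)) (x₀ : Vec d) where
  m : ℕ
  U : Set (Vec d)
  isOpen_U : IsOpen U
  mem_U : x₀ ∈ U
  F : Vec d → Vec m
  contDiffOn_F : ContDiffOn ℝ (p : WithTop ℕ∞) F U
  surjective_fderiv : ∀ x ∈ U, Function.Surjective (fderiv ℝ F x)
  inter_eq : M ∩ U = {x | x ∈ U ∧ F x = 0}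

/-- The tangent space `T_M(y) = ker ∇F(y)`, for `y ∈ M` near `x₀`. -/
def LocalDefiningMap.tangentSpace {d p : ℕ} {M : Set (Vec d)} {x₀ : Vec d}
    (φ : LocalDefiningMap p M x₀) (y : Vec d) : Submodule ℝ (Vec d) :=
  LinearMap.ker (fderiv ℝ φ.F y).toLinearMap

/-- The smooth extension `f_M = f ∘ P_M`. -/
def smoothExt {d : ℕ} (f : Vec d → ℝ) (M : Set (Vec d)) (x : Vec d) : ℝ := f (proj M x)

/-- The covariant gradient `∇_M f(y) = ∇ f_M(y)`, for `y ∈ M`. -/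
def covGrad {d : ℕ} (f : Vec d → ℝ) (M : Set (Vec d)) (y : Vec d) : Vec d :=
  gradient (smoothExt f M) y

/-- `M` (which is a `C^p` manifold around `x₀` by `φ`) is an active `C^p` manifold of `f` around
the critical point `x₀`. -/
structure IsActiveManifold {d p : ℕ} (f : Vec d → ℝ) {M : Set (Vec d)} {x₀ : Vec d}
    (_φ : LocalDefiningMap p M x₀) : Prop where
  mem : x₀ ∈ M
  critical : (0 : Vec d) ∈ clarkeSubdiff f x₀
  smooth : ∃ (V : Set (Vec d)) (g : Vec d → ℝ), IsOpen V ∧ x₀ ∈ V ∧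
    ContDiffOn ℝ (p : WithTop ℕ∞) g V ∧ ∀ y ∈ V ∩ M, g y = f y
  sharp : ∃ U ∈ 𝓝 x₀, ∃ c > (0 : ℝ), ∀ x ∈ U \ M, ∀ v ∈ clarkeSubdiff f x, c ≤ ‖v‖

/-- The structural assumption on `f` at the local minimizer `x₀`, with active manifold `M`,
quadratic growth constant `γ` and strong (a) constant `Ca`. -/
structure MainAssumption {d : ℕ} (f : Vec d → ℝ) {M : Set (Vec d)} {x₀ : Vec d}
    (φ : LocalDefiningMap 4 M x₀) (γ Ca : ℝ) : Prop where
  locallyLipschitz : LocallyLipschitz f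
  isLocalMin : IsLocalMin f x₀
  γ_pos : 0 < γ
  quadraticGrowth : ∀ᶠ x in 𝓝 x₀, γ / 2 * ‖x - x₀‖ ^ 2 ≤ f x - f x₀
  activeManifold : IsActiveManifold f φ
  Ca_pos : 0 < Ca
  strongA : ∀ᶠ q : Vec d × Vec d in 𝓝 (x₀, x₀), q.2 ∈ M → ∀ v ∈ clarkeSubdiff f q.1,
    ‖(φ.tangentSpace q.2).starProjection (v - covGrad f M q.2)‖ ≤ Ca * ‖q.1 - q.2‖
  bRegular : ∃ o : ℝ → ℝ, Tendsto (fun t => o t / t) (𝓝[≠] 0) (𝓝 0) ∧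
    ∀ᶠ q : Vec d × Vec d in 𝓝 (x₀, x₀), q.2 ∈ M → ∀ v ∈ clarkeSubdiff f q.1,
      f q.1 + inner ℝ v (q.2 - q.1) + o ‖q.2 - q.1‖ ≤ f q.2

/-- `L = 2 lip_f(x₀)`. -/
def constL {d : ℕ} (f : Vec d → ℝ) (x₀ : Vec d) : ℝ≥0∞ := 2 * lipAt f x₀

/-- `β = 2 lip_{∇ f_M}(x₀)`. -/
def constBeta {d : ℕ} (f : Vec d → ℝ) (M : Set (Vec d)) (x₀ : Vec d) : ℝ≥0∞ :=
  2 * lipAt (gradient (smoothExt f M)) x₀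

/-- `C_M = 2 lip_{∇ P_M}(x₀)`, in the operator norm. -/
def constCM {d : ℕ} (M : Set (Vec d)) (x₀ : Vec d) : ℝ≥0∞ :=
  2 * lipAt (fderiv ℝ (proj M)) x₀

/-- `μ` is one quarter of the limit inferior of `dist(0, ∂f(x))` as `x → x₀`, `x ∉ M`. It is `∞` if
`M` is a neighbourhood of `x₀`. -/
def constMu {d : ℕ} (f : Vec d → ℝ) (M : Set (Vec d)) (x₀ : Vec d) : ℝ≥0∞ :=
  liminf (fun x => Metric.infEDist 0 (clarkeSubdiff f x)) (𝓝[Mᶜ] x₀) / 4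

/-- `D₁ = μ / (8 (μ + L))`, read as its limit `1 / 8` if `μ = ∞`. -/
def constD1 {d : ℕ} (f : Vec d → ℝ) (M : Set (Vec d)) (x₀ : Vec d) : ℝ≥0∞ :=
  open Classical in
  if constMu f M x₀ = ∞ then 1 / 8
  else constMu f M x₀ / (8 * (constMu f M x₀ + constL f x₀))

/-- `C₂ = min {γ / (8 Ca), min {1, 1 / δA} / 2}`. -/
def constC2 (γ Ca δA : ℝ) : ℝ := min (γ / (8 * Ca)) (min 1 (1 / δA) / 2)

/-- `δ_GI = min {δA / 4, D₁ / C_M}` (where `D₁ / 0 = ∞`). -/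
def deltaGI {d : ℕ} (f : Vec d → ℝ) (M : Set (Vec d)) (x₀ : Vec d) (δA : ℝ) : ℝ≥0∞ :=
  min (ENNReal.ofReal (δA / 4)) (constD1 f M x₀ / constCM M x₀)

/-- The constant
`η = min {γ a₂ / (8 max {4 L a₂², β}), μ a₁ / (4 max {2 L, β / a₂²})}`. -/
def constEta {d : ℕ} (f : Vec d → ℝ) (M : Set (Vec d)) (x₀ : Vec d) (γ a₁ a₂ : ℝ) : ℝ≥0∞ :=
  min
    (ENNReal.ofReal (γ * a₂) /
      (8 * max (4 * constL f x₀ * ENNReal.ofReal (a₂ ^ 2)) (constBeta f M x₀)))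
    (constMu f M x₀ * ENNReal.ofReal a₁ /
      (4 * max (2 * constL f x₀) (constBeta f M x₀ / ENNReal.ofReal (a₂ ^ 2))))

/-- The normal region. -/
def NormalRegion {d : ℕ} (M : Set (Vec d)) (x₀ : Vec d) (a₁ a₂ : ℝ) (x : Vec d) (σ : ℝ) : Prop :=
  a₁ / 2 * Metric.infDist x M ≤ σ ∧ σ ≤ a₁ * Metric.infDist x M ∧
    a₂ ^ 2 * ‖proj M x - x₀‖ ^ 2 ≤ Metric.infDist x M

/-- The tangent region. -/
def TangentRegion {d : ℕ} (M : Set (Vec d)) (x₀ : Vec d) (a₂ : ℝ) (x : Vec d) (σ : ℝ) : Prop :=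
  a₂ / 2 * ‖proj M x - x₀‖ ≤ σ ∧ σ ≤ a₂ * ‖proj M x - x₀‖ ∧
    Metric.infDist x M / σ ≤ 2 * a₂ * ‖proj M x - x₀‖

end

/-!
Near `x₀` the map `(p, l) ↦ (p + F'(p)^* l, F p)`, for a local defining map `F` of `M`, has an
invertible derivative at `(x₀, 0)`; its local inverse gives the projection `P_M`, which is
therefore smooth, and so is `f_M = f ∘ P_M`. Quadratic growth of `f_M` along `M` gives
`‖∇ f_M p‖ ≥ (γ / 2) ‖p - x₀‖`.

Off `M` the subgradients are bounded away from `0`, so by Fermat's rule minimizers of the penalized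
functions `f + κ ‖· - y‖` lie on `M`. This produces a sharp growth of `f` away from `M`, and the
`(b)`-regularity turns it into a lower bound for `⟪v, y - p⟫`, `v ∈ ∂f(y)`, `p ∈ M`. In the normal
region all subgradients on the ball of radius `σ` thus have a component at least `μ / 2` along
`x - P_M x`; in the tangent region the strong `(a)`-regularity gives them a component at least
`(γ / 4) ‖P_M x - x₀‖` along `∇ f_M (P_M x)`. Such half-space bounds survive the convex hull, hence
bound `dist(0, ∂_σ f(x))` from below, while
`f x - f x₀ ≤ L dist(x, M) + (β / 2) ‖P_M x - x₀‖²` bounds the other side.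
-/

open MeasureTheory Metric
open ContinuousLinearMap (adjoint)

section MeanValue

variable {E : Type*} [NormedAddCommGroup E] [NormedSpace ℝ E]

lemma sub_le_mul_of_ae_fderiv_le {f : E → ℝ} {K : NNReal}
    (hf : LipschitzWith K f) {u h : E} {c t : ℝ} (ht : 0 ≤ t)
    (hdiff : ∀ᵐ s : ℝ, DifferentiableAt ℝ f (u + s • h))
    (hc : ∀ s ∈ Set.Icc 0 t, DifferentiableAt ℝ f (u + s • h) → fderiv ℝ f (u + s • h) h ≤ c) :
    f (u + t • h) - f u ≤ c * t := by
  set g : ℝ → ℝ := fun s => f (u + s • h)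
  have hline (s : ℝ) : HasDerivAt (fun s : ℝ => u + s • h) h s := by
    simpa using ((hasDerivAt_id s).smul_const h).const_add u
  have hg : LipschitzWith (K * ‖h‖₊) g := by
    refine hf.comp (LipschitzWith.of_dist_le_mul fun s s' => ?_)
    simp [dist_eq_norm, ← sub_smul, norm_smul, mul_comm]
  have hac : AbsolutelyContinuousOnInterval g 0 t :=
    hg.lipschitzOnWith.absolutelyContinuousOnInterval
  have hderiv : deriv g ≤ᵐ[volume.restrict (Set.Icc 0 t)] fun _ => c := by
    filter_upwards [ae_restrict_of_ae hdiff, ae_restrict_mem measurableSet_Icc] with s hs hst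
    exact (hs.hasFDerivAt.comp_hasDerivAt s (hline s)).deriv.trans_le (hc s hst hs)
  calc f (u + t • h) - f u = g t - g 0 := by simp [g]
    _ = ∫ s in 0..t, deriv g s := hac.integral_deriv_eq_sub.symm
    _ ≤ ∫ _ in 0..t, c := intervalIntegral.integral_mono_ae_restrict ht
        hac.intervalIntegrable_deriv intervalIntegrable_const hderiv
    _ = c * t := by simp [mul_comm]

variable [FiniteDimensional ℝ E]

lemma frequently_differentiableAt_of_lipschitzOnWith {F : Type*} [NormedAddCommGroup F]
    [NormedSpace ℝ F] [FiniteDimensional ℝ F] {f : E → F} {x : E} {K : NNReal} {s : Set E}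
    (hs : s ∈ 𝓝 x) (hf : LipschitzOnWith K f s) : ∃ᶠ u in 𝓝 x, DifferentiableAt ℝ f u := by
  let _ : MeasurableSpace E := borel E
  have : BorelSpace E := ⟨rfl⟩
  have hdense : Dense {u | u ∈ s → DifferentiableWithinAt ℝ f s u} :=
    Measure.dense_of_ae (hf.ae_differentiableWithinAt_of_mem (μ := Measure.addHaar))
  have hfreq : ∃ᶠ u in 𝓝 x, u ∈ s → DifferentiableWithinAt ℝ f s u :=
    mem_closure_iff_frequently.1 (hdense x)
  exact (hfreq.and_eventually (eventually_mem_nhds_iff.2 hs)).mono fun u hu =>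
    (hu.1 (mem_of_mem_nhds hu.2)).differentiableAt hu.2

lemma dense_setOf_ae_differentiableAt_line [MeasurableSpace E] [BorelSpace E] {f : E → ℝ}
    {K : NNReal} (hf : LipschitzWith K f) (h : E) :
    Dense {u : E | ∀ᵐ s : ℝ, DifferentiableAt ℝ f (u + s • h)} := by
  refine Measure.dense_of_ae (μ := Measure.addHaar) ?_
  rw [Measure.ae_ae_comm]
  · refine .of_forall fun s => ?_
    exact (measurePreserving_add_right Measure.addHaar (s • h)).quasiMeasurePreserving.ae
      hf.ae_differentiableAt
  · have hline : Measurable fun q : E × ℝ => q.1 + q.2 • h := by fun_prop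
    exact hline (measurableSet_of_differentiableAt ℝ f)

lemma sub_le_mul_of_fderiv_le {f : E → ℝ} {K : NNReal} (hf : LipschitzWith K f) {z h : E}
    {r c t : ℝ} (ht : 0 ≤ t) (htr : t * ‖h‖ < r)
    (hc : ∀ u ∈ ball z r, DifferentiableAt ℝ f u → fderiv ℝ f u h ≤ c) :
    f (z + t • h) - f z ≤ c * t := by
  let _ : MeasurableSpace E := borel E
  have : BorelSpace E := ⟨rfl⟩
  have hclosed : IsClosed {u | f (u + t • h) - f u ≤ c * t} :=
    isClosed_le ((hf.continuous.comp (by fun_prop)).sub hf.continuous) continuous_const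
  refine hclosed.closure_subset (mem_closure_iff_frequently.2 ?_)
  have hfreq := mem_closure_iff_frequently.1 (dense_setOf_ae_differentiableAt_line hf h z)
  refine (hfreq.and_eventually (ball_mem_nhds z (sub_pos.2 htr))).mono fun u hu =>
    sub_le_mul_of_ae_fderiv_le hf ht hu.1 fun s hs => hc _ ?_
  have hu' : dist u z < r - t * ‖h‖ := hu.2
  have hs' : dist (u + s • h) u ≤ t * ‖h‖ := by
    simpa [dist_eq_norm, norm_smul, abs_of_nonneg hs.1]
      using mul_le_mul_of_nonneg_right hs.2 (norm_nonneg h)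
  exact (dist_triangle _ u z).trans_lt
    ((add_lt_add_of_le_of_lt hs' hu').trans_eq (add_sub_cancel _ _))

end MeanValue

lemma exists_sq_norm_le_inner_of_lt_infEDist {E : Type*} [NormedAddCommGroup E]
    [InnerProductSpace ℝ E] [CompleteSpace E] {C : Set E} (hC : Convex ℝ C) (hne : C.Nonempty)
    {κ : ℝ} (hκ : ENNReal.ofReal κ < infEDist 0 C) :
    ∃ v, κ < ‖v‖ ∧ ∀ y ∈ C, ‖v‖ ^ 2 ≤ inner ℝ y v := by
  obtain ⟨v, hv, hmin⟩ :=
    exists_norm_eq_iInf_of_complete_convex hne.closure isClosed_closure.isComplete hC.closure 0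
  refine ⟨v, ?_, fun y hy => ?_⟩
  · rw [← infEDist_closure] at hκ
    have hlt := hκ.trans_le (infEDist_le_edist_of_mem hv)
    rw [edist_dist, dist_zero_left] at hlt
    exact lt_of_not_ge fun h => hlt.not_ge (ENNReal.ofReal_le_ofReal h)
  · have hproj := (norm_eq_iInf_iff_real_inner_le_zero hC.closure hv).1 hmin y (subset_closure hy)
    rw [zero_sub, inner_neg_left, inner_sub_right, real_inner_self_eq_norm_sq,
      real_inner_comm] at hproj
    linarith

section ClarkeSubdifferential

variable {d : ℕ} {f : Vec d → ℝ} {x v : Vec d} {K : NNReal} {s Q : Set (Vec d)}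

lemma norm_gradient_le_of_lipschitzOnWith (hs : s ∈ 𝓝 x) (hf : LipschitzOnWith K f s) :
    ‖gradient f x‖ ≤ K := by
  rw [gradient, LinearIsometryEquiv.norm_map]
  exact norm_fderiv_le_of_lipschitzOn ℝ hs hf

lemma norm_le_of_mem_clarkeSubdiff (hs : s ∈ 𝓝 x) (hf : LipschitzOnWith K f s)
    (hv : v ∈ clarkeSubdiff f x) : ‖v‖ ≤ K := by
  suffices clarkeSubdiff f x ⊆ closedBall 0 K by simpa using this hv
  refine convexHull_min ?_ (convex_closedBall _ _)
  rintro w ⟨u, -, hu, hw⟩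
  refine isClosed_closedBall.mem_of_tendsto hw ?_
  filter_upwards [hu.eventually (eventually_mem_nhds_iff.2 hs)] with i hi
  simpa using norm_gradient_le_of_lipschitzOnWith hi hf

lemma clarkeSubdiff_inter_nonempty (hs : s ∈ 𝓝 x) (hf : LipschitzOnWith K f s) (hQ : IsClosed Q)
    (h : ∃ᶠ u in 𝓝 x, DifferentiableAt ℝ f u ∧ gradient f u ∈ Q) :
    (clarkeSubdiff f x ∩ Q).Nonempty := by
  obtain ⟨u, hu, hdiff⟩ :=
    exists_seq_forall_of_frequently (h.and_eventually (eventually_mem_nhds_iff.2 hs))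
  obtain ⟨v, -, ψ, hψ, hv⟩ := (isCompact_closedBall (0 : Vec d) K).tendsto_subseq
    (x := fun i => gradient f (u i))
    fun i => by simpa using norm_gradient_le_of_lipschitzOnWith (hdiff i).2 hf
  exact ⟨v, subset_convexHull _ _
      ⟨u ∘ ψ, fun i => (hdiff _).1.1, hu.comp hψ.tendsto_atTop, hv⟩,
    hQ.mem_of_tendsto hv (.of_forall fun i => (hdiff _).1.2)⟩

lemma clarkeSubdiff_nonempty (hs : s ∈ 𝓝 x) (hf : LipschitzOnWith K f s) :
    (clarkeSubdiff f x).Nonempty :=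
  (clarkeSubdiff_inter_nonempty hs hf isClosed_univ
    ((frequently_differentiableAt_of_lipschitzOnWith hs hf).mono fun _ hu => ⟨hu, trivial⟩)).left

lemma eventually_sub_le_mul_of_inner_clarkeSubdiff_le (hs : s ∈ 𝓝 x) (hf : LipschitzOnWith K f s)
    {h : Vec d} {a b : ℝ} (hab : a < b) (ha : ∀ v ∈ clarkeSubdiff f x, inner ℝ v h ≤ a) :
    ∀ᶠ t : ℝ in 𝓝[>] 0, f (x + t • h) - f x ≤ b * t := by
  obtain ⟨g, hg, hfg⟩ := hf.extend_real
  have hgradient : ∀ᶠ u in 𝓝 x, DifferentiableAt ℝ f u → inner ℝ (gradient f u) h ≤ b := by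
    by_contra hfreq
    obtain ⟨v, hv, hvb⟩ := clarkeSubdiff_inter_nonempty (Q := {v | b ≤ inner ℝ v h}) hs hf
      (isClosed_le continuous_const (by fun_prop))
      ((not_eventually.1 hfreq).mono fun u hu => by
        rw [Classical.not_imp, not_le] at hu
        exact ⟨hu.1, hu.2.le⟩)
    exact (hab.trans_le (hvb.trans (ha v hv))).false
  obtain ⟨r, hr, hball⟩ :=
    eventually_nhds_iff_ball.1 (hgradient.and (eventually_mem_nhds_iff.2 hs))
  have hfderiv : ∀ u ∈ ball x r, DifferentiableAt ℝ g u → fderiv ℝ g u h ≤ b := by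
    intro u hu hgu
    have heq : f =ᶠ[𝓝 u] g := eventually_of_mem (hball u hu).2 hfg
    rw [← heq.fderiv_eq, ← inner_gradient_left]
    exact (hball u hu).1 (hgu.congr_of_eventuallyEq heq)
  have hline : Tendsto (fun t : ℝ => x + t • h) (𝓝[>] 0) (𝓝 x) :=
    (Continuous.tendsto' (by fun_prop) 0 x (by simp)).mono_left nhdsWithin_le_nhds
  filter_upwards [hline.eventually (ball_mem_nhds x hr), hline.eventually hs,
    self_mem_nhdsWithin] with t htr hts ht
  rw [hfg hts, hfg (mem_of_mem_nhds hs)]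
  refine sub_le_mul_of_fderiv_le hg (le_of_lt ht) ?_ hfderiv
  simpa [dist_eq_norm, norm_smul, abs_of_pos (Set.mem_Ioi.1 ht)] using htr

lemma infEDist_clarkeSubdiff_le_of_isLocalMin (hs : s ∈ 𝓝 x) (hf : LipschitzOnWith K f s) {κ : ℝ}
    (hκ : 0 ≤ κ) (hmin : IsLocalMin (fun w => f w + κ * ‖w - x‖) x) :
    infEDist 0 (clarkeSubdiff f x) ≤ ENNReal.ofReal κ := by
  by_contra! hlt
  obtain ⟨v, hκv, hv⟩ := exists_sq_norm_le_inner_of_lt_infEDist (C := clarkeSubdiff f x)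
    (convex_convexHull ℝ _) (clarkeSubdiff_nonempty hs hf) hlt
  have hvpos : 0 < ‖v‖ := hκ.trans_lt hκv
  obtain ⟨b, hvb, hbκ⟩ := exists_between (neg_lt_neg (mul_lt_mul_of_pos_right hκv hvpos))
  have hdescent := eventually_sub_le_mul_of_inner_clarkeSubdiff_le hs hf (h := -v) hvb
    fun y hy => by rw [inner_neg_right, ← sq]; exact neg_le_neg (hv y hy)
  have hline : Tendsto (fun t : ℝ => x + t • -v) (𝓝[>] 0) (𝓝 x) :=
    (Continuous.tendsto' (by fun_prop) 0 x (by simp)).mono_left nhdsWithin_le_nhds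
  obtain ⟨t, ht, hmint, htpos⟩ :=
    (hdescent.and ((hline.eventually hmin).and self_mem_nhdsWithin)).exists
  simp only [sub_self, norm_zero, mul_zero, add_zero, add_sub_cancel_left, norm_smul, norm_neg,
    Real.norm_eq_abs, abs_of_pos htpos] at hmint
  nlinarith

end ClarkeSubdifferential

section Projection

variable {d : ℕ} {M : Set (Vec d)} {x₀ x p : Vec d}

lemma proj_mem_projSet (h : (projSet M x).Nonempty) : proj M x ∈ projSet M x :=
  Classical.epsilon_spec h

lemma proj_eq_self_of_mem (hx : x ∈ M) : proj M x = x := by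
  have hmem : proj M x ∈ projSet M x := proj_mem_projSet ⟨x, hx, fun _ _ => by simp⟩
  simpa [sub_eq_zero] using hmem.2 x hx

lemma norm_sub_le_of_mem_projSet {a : Vec d} (ha : a ∈ M) (hp : p ∈ projSet M x) :
    ‖p - a‖ ≤ 2 * ‖x - a‖ := by
  have hpa : ‖p - x‖ ≤ ‖x - a‖ := norm_sub_rev a x ▸ hp.2 a ha
  linarith [norm_sub_le_norm_sub_add_norm_sub p x a]

lemma infDist_eq_of_mem_projSet (hp : p ∈ projSet M x) : infDist x M = ‖x - p‖ := by
  refine le_antisymm ((infDist_le_dist_of_mem hp.1).trans_eq (dist_eq_norm _ _)) ?_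
  refine (le_infDist ⟨p, hp.1⟩).2 fun z hz => ?_
  rw [dist_comm, dist_eq_norm, norm_sub_rev x]
  exact hp.2 z hz

lemma eventually_projSet_nonempty {r : ℝ} (hr : 0 < r) (hM : x₀ ∈ M)
    (hcomp : IsCompact (M ∩ closedBall x₀ r)) : ∀ᶠ x in 𝓝 x₀, (projSet M x).Nonempty := by
  filter_upwards [ball_mem_nhds x₀ (half_pos hr)] with x hx
  have hx₀ : x₀ ∈ M ∩ closedBall x₀ r := ⟨hM, mem_closedBall_self hr.le⟩
  obtain ⟨q, hq, hmin⟩ := hcomp.exists_isMinOn ⟨x₀, hx₀⟩ (f := fun y => dist y x) (by fun_prop)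
  refine ⟨q, hq.1, fun z hz => ?_⟩
  rw [← dist_eq_norm, ← dist_eq_norm]
  by_cases hzr : z ∈ closedBall x₀ r
  · exact hmin ⟨hz, hzr⟩
  · have hqx : dist q x ≤ dist x x₀ := dist_comm x₀ x ▸ hmin hx₀
    rw [mem_closedBall, not_le] at hzr
    rw [mem_ball] at hx
    linarith [dist_triangle z x x₀]

lemma tendsto_proj (hM : x₀ ∈ M) (hproj : ∀ᶠ x in 𝓝 x₀, proj M x ∈ projSet M x) :
    Tendsto (proj M) (𝓝 x₀) (𝓝 x₀) := by
  rw [tendsto_iff_norm_sub_tendsto_zero]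
  refine squeeze_zero' (.of_forall fun x => norm_nonneg _)
    (hproj.mono fun x hx => norm_sub_le_of_mem_projSet hM hx) ?_
  exact Continuous.tendsto' (by fun_prop) _ _ (by simp)

lemma LocalDefiningMap.mem_iff {k : ℕ} (φ : LocalDefiningMap k M x₀) (hx : x ∈ φ.U) :
    x ∈ M ↔ φ.F x = 0 := by
  simpa [hx] using Set.ext_iff.1 φ.inter_eq x

lemma LocalDefiningMap.U_mem_nhds {k : ℕ} (φ : LocalDefiningMap k M x₀) : φ.U ∈ 𝓝 x₀ :=
  φ.isOpen_U.mem_nhds φ.mem_U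

lemma LocalDefiningMap.contDiffAt_F {k : ℕ} (φ : LocalDefiningMap k M x₀) (hx : x ∈ φ.U) :
    ContDiffAt ℝ k φ.F x :=
  φ.contDiffOn_F.contDiffAt (φ.isOpen_U.mem_nhds hx)

lemma LocalDefiningMap.eventually_proj_mem {k : ℕ} (φ : LocalDefiningMap k M x₀) (hM : x₀ ∈ M) :
    ∀ᶠ x in 𝓝 x₀, proj M x ∈ projSet M x := by
  obtain ⟨r, hr, hrU⟩ := nhds_basis_closedBall.mem_iff.1 φ.U_mem_nhds
  have heq : M ∩ closedBall x₀ r = closedBall x₀ r ∩ φ.F ⁻¹' {0} := by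
    ext y
    rw [Set.inter_comm]
    exact and_congr_right fun hy => φ.mem_iff (hrU hy)
  have hclosed : IsClosed (M ∩ closedBall x₀ r) := heq ▸
    (φ.contDiffOn_F.continuousOn.mono hrU).preimage_isClosed_of_isClosed isClosed_closedBall
      isClosed_singleton
  exact (eventually_projSet_nonempty hr hM ((isCompact_closedBall x₀ r).of_isClosed_subset hclosed
    Set.inter_subset_right)).mono fun x => proj_mem_projSet

end Projection

section NormalCoordinates

variable {E F : Type*} [NormedAddCommGroup E] [InnerProductSpace ℝ E] [CompleteSpace E]
  [NormedAddCommGroup F] [InnerProductSpace ℝ F] [CompleteSpace F]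

/-- The adjoint of bounded operators between real Hilbert spaces, as a continuous linear map. -/
noncomputable def adjointL : (E →L[ℝ] F) →L[ℝ] (F →L[ℝ] E) :=
  LinearMap.mkContinuous
    { toFun := fun A => adjoint A
      map_add' := map_add adjoint
      map_smul' := fun c A => by simp } 1 fun A => by simp

@[simp] lemma adjointL_apply (A : E →L[ℝ] F) : adjointL A = adjoint A := rfl

/-- Normal coordinates along the fibres of `G`: the pair `(p, l)` stands for the point
`p + G'(p)^* l` on the normal space to the fibre of `G` through `p`, and the value `G p` is kept as
a second component to make the map locally invertible. -/
noncomputable def normalMap (G : E → F) (q : E × F) : E × F :=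
  (q.1 + adjointL (fderiv ℝ G q.1) q.2, G q.1)

lemma adjoint_injective_of_surjective {A : E →L[ℝ] F} (hA : Function.Surjective A) :
    Function.Injective (adjoint A) := by
  rw [injective_iff_map_eq_zero]
  intro l hl
  obtain ⟨w, rfl⟩ := hA l
  rw [← inner_self_eq_zero (𝕜 := ℝ), ← ContinuousLinearMap.adjoint_inner_left, hl, inner_zero_left]

lemma contDiffAt_normalMap {G : E → F} {x : E} {n : WithTop ℕ∞} (l : F)
    (hG : ContDiffAt ℝ (n + 1) G x) : ContDiffAt ℝ n (normalMap G) (x, l) := by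
  have hderiv : ContDiffAt ℝ n (fun q : E × F => adjointL (fderiv ℝ G q.1)) (x, l) :=
    adjointL.contDiff.contDiffAt.comp (x, l) ((hG.fderiv_right le_rfl).comp (x, l) contDiffAt_fst)
  exact (contDiffAt_fst.add (hderiv.clm_apply contDiffAt_snd)).prodMk
    ((hG.of_le le_self_add).comp (x, l) contDiffAt_fst)

lemma hasFDerivAt_normalMap_zero {G : E → F} {x : E} (hG : ContDiffAt ℝ 2 G x) :
    HasFDerivAt (normalMap G)
      ((ContinuousLinearMap.fst ℝ E F +
        (adjoint (fderiv ℝ G x)).comp (ContinuousLinearMap.snd ℝ E F)).prod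
        ((fderiv ℝ G x).comp (ContinuousLinearMap.fst ℝ E F))) (x, 0) := by
  have hadj : DifferentiableAt ℝ (fun q : E × F => adjointL (fderiv ℝ G q.1)) (x, 0) :=
    (adjointL.contDiff.contDiffAt.comp (x, (0 : F)) ((hG.fderiv_right (m := 1) (by norm_num)).comp
      (x, (0 : F)) contDiffAt_fst)).differentiableAt (by norm_num)
  have hfst : HasFDerivAt Prod.fst (ContinuousLinearMap.fst ℝ E F) (x, (0 : F)) := hasFDerivAt_fst
  have hsnd : HasFDerivAt Prod.snd (ContinuousLinearMap.snd ℝ E F) (x, (0 : F)) := hasFDerivAt_snd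
  refine HasFDerivAt.prodMk ((hfst.add (hadj.hasFDerivAt.clm_apply hsnd)).congr_fderiv ?_)
    ((hG.differentiableAt (by norm_num)).hasFDerivAt.comp (x, (0 : F)) hfst)
  simp

lemma injective_fst_add_adjoint_snd_prod {A : E →L[ℝ] F} (hA : Function.Surjective A) :
    Function.Injective ((ContinuousLinearMap.fst ℝ E F +
      (adjoint A).comp (ContinuousLinearMap.snd ℝ E F)).prod
      (A.comp (ContinuousLinearMap.fst ℝ E F))) := by
  rw [injective_iff_map_eq_zero]
  rintro ⟨h, l⟩ hz
  obtain ⟨hsum, hker⟩ : h + adjoint A l = 0 ∧ A h = 0 := by simpa using hz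
  have hh : h = 0 := by
    have hinner : inner ℝ h (h + adjoint A l) = inner ℝ h h := by
      rw [inner_add_right, ContinuousLinearMap.adjoint_inner_right, hker, inner_zero_left, add_zero]
    rwa [hsum, inner_zero_right, eq_comm, inner_self_eq_zero] at hinner
  have hl : l = 0 := adjoint_injective_of_surjective hA (by simpa [hh] using hsum)
  rw [hh, hl, Prod.mk_zero_zero]

lemma exists_contDiffAt_leftInverse_normalMap [FiniteDimensional ℝ E] [FiniteDimensional ℝ F]
    {G : E → F} {x : E} {n : WithTop ℕ∞} (hn : n ≠ 0) (hG : ContDiffAt ℝ (n + 1) G x)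
    (hsurj : Function.Surjective (fderiv ℝ G x)) :
    ∃ g : E × F → E × F, ContDiffAt ℝ n g (x, G x) ∧
      ∀ᶠ q in 𝓝 (x, (0 : F)), g (normalMap G q) = q := by
  have hn1 : 1 ≤ n := ENat.one_le_iff_ne_zero_withTop.2 hn
  have hderiv := hasFDerivAt_normalMap_zero
    (hG.of_le (by simpa [one_add_one_eq_two] using add_le_add_left hn1 1))
  let T := (LinearEquiv.ofInjectiveEndo _
    (injective_fst_add_adjoint_snd_prod hsurj)).toContinuousLinearEquiv
  have hT : HasFDerivAt (normalMap G) (T : E × F →L[ℝ] E × F) (x, 0) := hderiv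
  have hsmooth := contDiffAt_normalMap 0 hG
  refine ⟨hsmooth.localInverse hT hn, ?_,
    (hsmooth.hasStrictFDerivAt' hT hn).eventually_left_inverse⟩
  simpa [normalMap] using hsmooth.to_localInverse hT hn

lemma exists_eventually_norm_le_mul_norm_apply {E F : Type*} [NormedAddCommGroup E]
    [NormedSpace ℝ E] [FiniteDimensional ℝ E] [NormedAddCommGroup F] [NormedSpace ℝ F]
    {A₀ : E →L[ℝ] F} (hA₀ : Function.Injective A₀) :
    ∃ C : ℝ, ∀ᶠ A in 𝓝 A₀, ∀ l, ‖l‖ ≤ C * ‖A l‖ := by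
  obtain ⟨K, hK, hanti⟩ := A₀.toLinearMap.exists_antilipschitzWith (LinearMap.ker_eq_bot.2 hA₀)
  have hK : (0 : ℝ) < K := hK
  refine ⟨2 * K, ?_⟩
  filter_upwards [ball_mem_nhds A₀ (by positivity : (0 : ℝ) < 1 / (2 * K))] with A hA l
  have hlow : ‖l‖ ≤ K * ‖A₀ l‖ := by simpa using hanti.le_mul_dist l 0
  have hdiff : K * ‖(A - A₀) l‖ ≤ ‖l‖ / 2 := by
    calc K * ‖(A - A₀) l‖ ≤ K * (1 / (2 * K) * ‖l‖) := by
          have hA : ‖A - A₀‖ ≤ 1 / (2 * K) := (mem_ball_iff_norm.1 hA).le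
          gcongr
          exact (A - A₀).le_of_opNorm_le hA l
      _ = ‖l‖ / 2 := by field_simp
  have htri : ‖A₀ l‖ ≤ ‖A l‖ + ‖(A - A₀) l‖ := norm_le_insert (A l) (A₀ l)
  linarith [mul_le_mul_of_nonneg_left htri hK.le]

end NormalCoordinates

section SmoothProjection

variable {d k : ℕ} {M : Set (Vec d)} {x₀ : Vec d}

lemma LocalDefiningMap.inner_sub_eq_zero_of_mem_ker (φ : LocalDefiningMap k M x₀) (hk : k ≠ 0)
    {x p w : Vec d} (hp : p ∈ projSet M x) (hpU : p ∈ φ.U) (hw : fderiv ℝ φ.F p w = 0) :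
    inner ℝ w (x - p) = 0 := by
  have hF : HasStrictFDerivAt φ.F (fderiv ℝ φ.F p) p :=
    (φ.contDiffAt_F hpU).hasStrictFDerivAt (by exact_mod_cast hk)
  have hdist : HasStrictFDerivAt (fun y : Vec d => ‖y - x‖ ^ 2)
      ((2 • innerSL ℝ (p - x)).comp (ContinuousLinearMap.id ℝ (Vec d))) p :=
    (hasStrictFDerivAt_norm_sq (p - x)).comp p ((hasStrictFDerivAt_id p).sub_const x)
  have hmin : IsLocalExtrOn (fun y : Vec d => ‖y - x‖ ^ 2) {y | φ.F y = φ.F p} p := by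
    left
    filter_upwards [self_mem_nhdsWithin, mem_nhdsWithin_of_mem_nhds (φ.isOpen_U.mem_nhds hpU)]
      with y hy hyU
    have hyM : y ∈ M := (φ.mem_iff hyU).2 (hy.trans ((φ.mem_iff hpU).1 hp.1))
    exact pow_le_pow_left₀ (norm_nonneg _) (hp.2 y hyM) 2
  obtain ⟨Λ, Λ₀, hne, hΛ⟩ := hmin.exists_linear_map_of_hasStrictFDerivAt hF hdist
  have hΛ₀ : Λ₀ ≠ 0 := by
    rintro rfl
    refine hne (Prod.ext (LinearMap.ext fun u => ?_) rfl)
    obtain ⟨y, rfl⟩ := φ.surjective_fderiv p hpU u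
    simpa using hΛ y
  have hinner : inner ℝ (p - x) w = 0 := by simpa [hw, hΛ₀, inner_sub_left] using hΛ w
  rw [real_inner_comm, ← neg_sub, inner_neg_left, hinner, neg_zero]

lemma LocalDefiningMap.sub_mem_range_adjoint (φ : LocalDefiningMap k M x₀) (hk : k ≠ 0)
    {x p : Vec d} (hp : p ∈ projSet M x) (hpU : p ∈ φ.U) :
    ∃ l, adjoint (fderiv ℝ φ.F p) l = x - p := by
  have hmem : x - p ∈ (fderiv ℝ φ.F p).toLinearMap.kerᗮ :=
    fun w hw => φ.inner_sub_eq_zero_of_mem_ker hk hp hpU hw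
  rwa [LinearMap.orthogonal_ker] at hmem

lemma LocalDefiningMap.exists_norm_le_mul_norm_adjoint (φ : LocalDefiningMap k M x₀)
    (hk : k ≠ 0) :
    ∃ C : ℝ, ∀ᶠ p in 𝓝 x₀, ∀ l, ‖l‖ ≤ C * ‖adjoint (fderiv ℝ φ.F p) l‖ := by
  obtain ⟨C, hC⟩ := exists_eventually_norm_le_mul_norm_apply
    (adjoint_injective_of_surjective (φ.surjective_fderiv x₀ φ.mem_U))
  have hcont : ContinuousAt (fun p => adjointL (fderiv ℝ φ.F p)) x₀ :=
    adjointL.continuous.continuousAt.comp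
      ((φ.contDiffAt_F φ.mem_U).continuousAt_fderiv (by exact_mod_cast hk))
  exact ⟨C, hcont.eventually hC⟩

lemma LocalDefiningMap.eventually_exists_normalMap_eq (φ : LocalDefiningMap k M x₀) (hk : k ≠ 0)
    (hM : x₀ ∈ M) {N : Set (Vec d × Vec φ.m)} (hN : N ∈ 𝓝 (x₀, 0)) :
    ∀ᶠ x in 𝓝 x₀, ∃ l, (proj M x, l) ∈ N ∧ normalMap φ.F (proj M x, l) = (x, 0) := by
  have hproj := φ.eventually_proj_mem hM
  have htendsto := tendsto_proj hM hproj
  obtain ⟨C, hC⟩ := φ.exists_norm_le_mul_norm_adjoint hk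
  obtain ⟨ρ, hρ, hNρ⟩ := Metric.mem_nhds_iff.1 hN
  have hsmall : ∀ᶠ x in 𝓝 x₀, C * ‖x - proj M x‖ < ρ := by
    have : Tendsto (fun x => C * ‖x - proj M x‖) (𝓝 x₀) (𝓝 (C * ‖x₀ - x₀‖)) :=
      ((tendsto_id.sub htendsto).norm).const_mul C
    exact this.eventually_lt_const (by simpa using hρ)
  filter_upwards [hproj, hsmall, htendsto.eventually hC, htendsto.eventually φ.U_mem_nhds,
    htendsto.eventually (ball_mem_nhds x₀ hρ)] with x hx hxρ hxC hxU hpρ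
  obtain ⟨l, hl⟩ := φ.sub_mem_range_adjoint hk hx hxU
  have hlρ : ‖l‖ < ρ := (hl ▸ hxC l).trans_lt hxρ
  refine ⟨l, hNρ ?_, ?_⟩
  · simpa [Prod.dist_eq] using ⟨hpρ, hlρ⟩
  · simp [normalMap, hl, (φ.mem_iff hxU).1 hx.1]

lemma LocalDefiningMap.contDiffAt_proj (φ : LocalDefiningMap k M x₀) {n : ℕ} (hn : n ≠ 0)
    (hnk : n + 1 ≤ k) (hM : x₀ ∈ M) : ContDiffAt ℝ n (proj M) x₀ := by
  have hF : ContDiffAt ℝ (n + 1) φ.F x₀ :=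
    (φ.contDiffAt_F φ.mem_U).of_le (by exact_mod_cast hnk)
  obtain ⟨g, hg, hleft⟩ := exists_contDiffAt_leftInverse_normalMap (by exact_mod_cast hn) hF
    (φ.surjective_fderiv x₀ φ.mem_U)
  rw [(φ.mem_iff φ.mem_U).1 hM] at hg
  have heq : proj M =ᶠ[𝓝 x₀] fun x => (g (x, 0)).1 := by
    filter_upwards [φ.eventually_exists_normalMap_eq (by lia) hM hleft] with x hx
    obtain ⟨l, hl, hlx⟩ := hx
    have hl' : g (normalMap φ.F (proj M x, l)) = (proj M x, l) := hl
    rw [← hlx, hl']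
  exact (contDiffAt_fst.comp x₀ (hg.comp x₀ (contDiffAt_id.prodMk contDiffAt_const))
    ).congr_of_eventuallyEq heq

lemma LocalDefiningMap.eventually_proj_normalMap (φ : LocalDefiningMap k M x₀) (hk : 2 ≤ k)
    (hM : x₀ ∈ M) :
    ∀ᶠ q in 𝓝 (x₀, (0 : Vec φ.m)), q.1 ∈ M → proj M (normalMap φ.F q).1 = q.1 := by
  have hF : ContDiffAt ℝ (1 + 1) φ.F x₀ := (φ.contDiffAt_F φ.mem_U).of_le (by exact_mod_cast hk)
  obtain ⟨g, -, hleft⟩ := exists_contDiffAt_leftInverse_normalMap one_ne_zero hF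
    (φ.surjective_fderiv x₀ φ.mem_U)
  have hcont : Tendsto (fun q => (normalMap φ.F q).1) (𝓝 (x₀, (0 : Vec φ.m))) (𝓝 x₀) := by
    simpa [normalMap] using (contDiffAt_normalMap 0 hF).continuousAt.fst.tendsto
  filter_upwards [hleft, hcont.eventually (φ.eventually_exists_normalMap_eq (by lia) hM hleft),
    continuousAt_fst.eventually φ.U_mem_nhds] with q hq hproj hqU hqM
  obtain ⟨l, hl, hlq⟩ := hproj
  have hFq : normalMap φ.F q = ((normalMap φ.F q).1, 0) :=
    Prod.ext rfl ((φ.mem_iff hqU).1 hqM)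
  have hl' : g (normalMap φ.F (proj M (normalMap φ.F q).1, l)) = _ := hl
  rw [hlq, ← hFq, hq] at hl'
  exact (congrArg Prod.fst hl').symm

end SmoothProjection

section LipschitzModulus

variable {X Y : Type*} [PseudoEMetricSpace Y] {x₀ : X}

lemma exists_lipschitzOnWith_of_lipAt_lt [MetricSpace X] {F : X → Y} {c : NNReal}
    (h : lipAt F x₀ < c) : ∃ s ∈ 𝓝 x₀, LipschitzOnWith c F s := by
  have hquot := eventually_lt_of_limsup_lt h
  rw [eventually_inf_principal, nhds_prod_eq, Filter.eventually_iff, mem_prod_self_iff] at hquot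
  obtain ⟨s, hs, hss⟩ := hquot
  refine ⟨s, hs, fun x hx y hy => ?_⟩
  rcases eq_or_ne x y with rfl | hxy
  · simp
  · exact (ENNReal.div_le_iff (edist_pos.2 hxy).ne' (edist_ne_top _ _)).1
      (hss (Set.mk_mem_prod hx hy) hxy).le

lemma lipAt_le_of_lipschitzOnWith [PseudoEMetricSpace X] {F : X → Y} {K : NNReal} {s : Set X}
    (hs : s ∈ 𝓝 x₀) (hF : LipschitzOnWith K F s) : lipAt F x₀ ≤ K := by
  refine limsup_le_of_le (h := .filter_mono inf_le_left ?_)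
  filter_upwards [prod_mem_nhds hs hs] with p hp
  exact ENNReal.div_le_of_le_mul (hF hp.1 hp.2)

lemma lipAt_ne_top_of_contDiffAt {E F : Type*} [NormedAddCommGroup E] [NormedSpace ℝ E]
    [NormedAddCommGroup F] [NormedSpace ℝ F] {g : E → F} {x : E} (hg : ContDiffAt ℝ 1 g x) :
    lipAt g x ≠ ∞ := by
  obtain ⟨K, s, hs, hK⟩ := hg.exists_lipschitzOnWith
  exact ((lipAt_le_of_lipschitzOnWith hs hK).trans_lt ENNReal.coe_lt_top).ne

lemma exists_lipschitzOnWith_two_mul_lipAt [MetricSpace X] {F : X → Y} (h₀ : lipAt F x₀ ≠ 0)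
    (htop : lipAt F x₀ ≠ ∞) : ∃ s ∈ 𝓝 x₀, LipschitzOnWith (2 * lipAt F x₀).toNNReal F s := by
  refine exists_lipschitzOnWith_of_lipAt_lt ?_
  rw [ENNReal.coe_toNNReal (ENNReal.mul_ne_top (by norm_num) htop), two_mul]
  exact ENNReal.lt_add_right htop h₀

lemma lipAt_gradient {E : Type*} [NormedAddCommGroup E] [InnerProductSpace ℝ E] [CompleteSpace E]
    (g : E → ℝ) (x : E) : lipAt (gradient g) x = lipAt (fderiv ℝ g) x := by
  have hedist (y z : E) :
      edist (gradient g y) (gradient g z) = edist (fderiv ℝ g y) (fderiv ℝ g z) :=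
    (InnerProductSpace.toDual ℝ E).symm.isometry.edist_eq _ _
  simp only [lipAt, hedist]

end LipschitzModulus

section SecondOrder

variable {E : Type*} [NormedAddCommGroup E] [NormedSpace ℝ E] {g : E → ℝ} {x₀ x h : E}

lemma eventually_segment {P : E → Prop} (hP : ∀ᶠ x in 𝓝 x₀, P x) :
    ∀ᶠ x in 𝓝 x₀, ∀ t ∈ Set.Icc (0 : ℝ) 1, P (x₀ + t • (x - x₀)) := by
  obtain ⟨r, hr, hball⟩ := eventually_nhds_iff_ball.1 hP
  filter_upwards [ball_mem_nhds x₀ hr] with x hx t ht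
  refine hball _ ?_
  rw [mem_ball_iff_norm, add_sub_cancel_left, norm_smul, Real.norm_of_nonneg ht.1]
  exact (mul_le_of_le_one_left (norm_nonneg _) ht.2).trans_lt (mem_ball_iff_norm.1 hx)

lemma sub_le_half_of_fderiv_le_mul {c : ℝ}
    (hd : ∀ t ∈ Set.Icc (0 : ℝ) 1, DifferentiableAt ℝ g (x + t • h))
    (hc : ∀ t ∈ Set.Icc (0 : ℝ) 1, fderiv ℝ g (x + t • h) h ≤ c * t) :
    g (x + h) - g x ≤ c / 2 := by
  have hderiv : ∀ t ∈ Set.Icc (0 : ℝ) 1, HasDerivAt (fun t : ℝ => g (x + t • h) - c / 2 * t ^ 2)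
      (fderiv ℝ g (x + t • h) h - c * t) t := by
    intro t ht
    have hline : HasDerivAt (fun t : ℝ => x + t • h) h t := by
      simpa using ((hasDerivAt_id t).smul_const h).const_add x
    refine (((hd t ht).hasFDerivAt.comp_hasDerivAt t hline).sub
      ((hasDerivAt_pow 2 t).const_mul (c / 2))).congr_deriv ?_
    simp only [Nat.cast_ofNat, Nat.add_one_sub_one, pow_one]
    ring
  have hanti : AntitoneOn (fun t : ℝ => g (x + t • h) - c / 2 * t ^ 2) (Set.Icc 0 1) := by
    refine antitoneOn_of_deriv_nonpos (convex_Icc 0 1) (HasDerivAt.continuousOn hderiv)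
      (fun t ht => (hderiv t (interior_subset ht)).differentiableAt.differentiableWithinAt)
      fun t ht => ?_
    rw [(hderiv t (interior_subset ht)).deriv]
    linarith [hc t (interior_subset ht)]
  have hends := hanti (Set.left_mem_Icc.2 zero_le_one) (Set.right_mem_Icc.2 zero_le_one) zero_le_one
  simp only [one_smul, zero_smul, add_zero, one_pow, mul_one] at hends
  linarith

lemma eventually_sub_le_half_mul_sq {c : NNReal} {s : Set E} (hs : s ∈ 𝓝 x₀)
    (hg : ∀ᶠ x in 𝓝 x₀, DifferentiableAt ℝ g x) (hg₀ : fderiv ℝ g x₀ = 0)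
    (hlip : LipschitzOnWith c (fderiv ℝ g) s) :
    ∀ᶠ x in 𝓝 x₀, g x - g x₀ ≤ c / 2 * ‖x - x₀‖ ^ 2 := by
  filter_upwards [eventually_segment hg, eventually_segment hs] with x hd hxs
  have htaylor := sub_le_half_of_fderiv_le_mul (c := c * ‖x - x₀‖ ^ 2) hd fun t ht => by
    have hnorm : ‖fderiv ℝ g (x₀ + t • (x - x₀))‖ ≤ c * (t * ‖x - x₀‖) := by
      simpa [hg₀, norm_smul, abs_of_nonneg ht.1, dist_eq_norm]
        using hlip.dist_le_mul _ (hxs t ht) _ (mem_of_mem_nhds hs)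
    calc fderiv ℝ g (x₀ + t • (x - x₀)) (x - x₀) ≤ c * (t * ‖x - x₀‖) * ‖x - x₀‖ :=
          (le_abs_self _).trans (ContinuousLinearMap.le_of_opNorm_le _ hnorm _)
      _ = c * ‖x - x₀‖ ^ 2 * t := by ring
  rw [add_sub_cancel] at htaylor
  linarith

lemma eventually_sub_le_half_fderiv_add (hg : ∀ᶠ x in 𝓝 x₀, DifferentiableAt ℝ g x)
    (hg₀ : fderiv ℝ g x₀ = 0) (hg' : DifferentiableAt ℝ (fderiv ℝ g) x₀) {ε : ℝ} (hε : 0 < ε) :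
    ∀ᶠ x in 𝓝 x₀, g x - g x₀ ≤ fderiv ℝ g x (x - x₀) / 2 + ε * ‖x - x₀‖ ^ 2 := by
  set H := fderiv ℝ (fderiv ℝ g) x₀
  have hH : ∀ᶠ x in 𝓝 x₀, ‖fderiv ℝ g x - H (x - x₀)‖ ≤ ε * ‖x - x₀‖ := by
    simpa [hg₀] using hg'.hasFDerivAt.isLittleO.def hε
  filter_upwards [eventually_segment hg, eventually_segment hH] with x hd hxH
  set h := x - x₀
  have hbound : ∀ t ∈ Set.Icc (0 : ℝ) 1,
      |fderiv ℝ g (x₀ + t • h) h - t * H h h| ≤ ε * ‖h‖ ^ 2 * t := by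
    intro t ht
    have hnorm : ‖fderiv ℝ g (x₀ + t • h) - H (t • h)‖ ≤ ε * (t * ‖h‖) := by
      simpa [norm_smul, abs_of_nonneg ht.1] using hxH t ht
    calc |fderiv ℝ g (x₀ + t • h) h - t * H h h|
        = ‖(fderiv ℝ g (x₀ + t • h) - H (t • h)) h‖ := by simp
      _ ≤ ε * (t * ‖h‖) * ‖h‖ := ContinuousLinearMap.le_of_opNorm_le _ hnorm _
      _ = ε * ‖h‖ ^ 2 * t := by ring
  have htaylor := sub_le_half_of_fderiv_le_mul (c := H h h + ε * ‖h‖ ^ 2) hd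
    fun t ht => by linarith [(abs_le.1 (hbound t ht)).2]
  have hend := (abs_le.1 (hbound 1 (Set.right_mem_Icc.2 zero_le_one))).1
  rw [one_smul, add_sub_cancel] at hend
  rw [add_sub_cancel] at htaylor
  linarith

end SecondOrder

section SmoothExtension

variable {d k : ℕ} {f : Vec d → ℝ} {M : Set (Vec d)} {x₀ : Vec d} {φ : LocalDefiningMap k M x₀}

lemma smoothExt_eq_self_of_mem {p : Vec d} (hp : p ∈ M) : smoothExt f M p = f p := by
  rw [smoothExt, proj_eq_self_of_mem hp]

lemma contDiffAt_smoothExt (hA : IsActiveManifold f φ) {n : ℕ} (hn : n ≠ 0) (hnk : n + 1 ≤ k) :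
    ContDiffAt ℝ n (smoothExt f M) x₀ := by
  obtain ⟨V, g, hV, hxV, hg, hgf⟩ := hA.smooth
  have hproj := φ.eventually_proj_mem hA.mem
  have hg' : ContDiffAt ℝ n g (proj M x₀) := by
    rw [proj_eq_self_of_mem hA.mem]
    exact (hg.contDiffAt (hV.mem_nhds hxV)).of_le (by exact_mod_cast (by lia : n ≤ k))
  refine (hg'.comp x₀ (φ.contDiffAt_proj hn hnk hA.mem)).congr_of_eventuallyEq ?_
  filter_upwards [hproj, (tendsto_proj hA.mem hproj).eventually (hV.mem_nhds hxV)] with x hx hxV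
  exact (hgf _ ⟨hxV, hx.1⟩).symm

lemma fderiv_smoothExt_eq_zero (hM : x₀ ∈ M) (hproj : ∀ᶠ x in 𝓝 x₀, proj M x ∈ projSet M x)
    (hmin : IsLocalMin f x₀) : fderiv ℝ (smoothExt f M) x₀ = 0 := by
  refine IsLocalMin.fderiv_eq_zero ?_
  filter_upwards [(tendsto_proj hM hproj).eventually hmin] with x hx
  rwa [smoothExt_eq_self_of_mem hM]

lemma eventually_differentiableAt_of_contDiffAt {E F : Type*} [NormedAddCommGroup E]
    [NormedSpace ℝ E] [NormedAddCommGroup F] [NormedSpace ℝ F] {g : E → F} {x : E} {n : ℕ}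
    (hn : n ≠ 0) (hg : ContDiffAt ℝ n g x) : ∀ᶠ y in 𝓝 x, DifferentiableAt ℝ g y :=
  (hg.eventually (by simp)).mono fun _ hy => hy.differentiableAt (by exact_mod_cast hn)

lemma eventually_covGrad_mem_tangentSpace (hk : 2 ≤ k) (hM : x₀ ∈ M)
    (hdiff : ∀ᶠ p in 𝓝 x₀, DifferentiableAt ℝ (smoothExt f M) p) :
    ∀ᶠ p in 𝓝 x₀, p ∈ M → covGrad f M p ∈ φ.tangentSpace p := by
  have hfibre : ∀ᶠ p in 𝓝 x₀, ∀ᶠ q in 𝓝 (p, (0 : Vec φ.m)),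
      q.1 ∈ M → proj M (normalMap φ.F q).1 = q.1 :=
    (Continuous.prodMk_left (0 : Vec φ.m)).continuousAt.eventually
      (φ.eventually_proj_normalMap hk hM).eventually_nhds
  filter_upwards [hfibre, hdiff] with p hp hdp hpM
  change fderiv ℝ φ.F p (covGrad f M p) = 0
  refine ext_inner_right ℝ fun l => ?_
  rw [inner_zero_left, ← ContinuousLinearMap.adjoint_inner_right, covGrad, inner_gradient_left]
  set w := adjoint (fderiv ℝ φ.F p) l
  have hline : HasDerivAt (fun t : ℝ => p + t • w) w 0 := by
    simpa using ((hasDerivAt_id (0 : ℝ)).smul_const w).const_add p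
  have hcomp : HasDerivAt (fun t : ℝ => smoothExt f M (p + t • w))
      (fderiv ℝ (smoothExt f M) p w) 0 :=
    hdp.hasFDerivAt.comp_hasDerivAt_of_eq (0 : ℝ) hline (by simp)
  have hconst : (fun t : ℝ => smoothExt f M (p + t • w)) =ᶠ[𝓝 0] fun _ => f p := by
    have htend : Tendsto (fun t : ℝ => (p, t • l)) (𝓝 0) (𝓝 (p, 0)) :=
      Continuous.tendsto' (by fun_prop) 0 _ (by simp)
    filter_upwards [htend.eventually hp] with t ht
    have hproj : proj M (p + t • w) = p := by simpa [normalMap, w] using ht hpM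
    rw [smoothExt, hproj]
  exact hcomp.unique ((hasDerivAt_const (0 : ℝ) (f p)).congr_of_eventuallyEq hconst)

lemma eventually_mul_norm_sub_le_norm_covGrad (hM : x₀ ∈ M)
    (hsmooth : ContDiffAt ℝ 2 (smoothExt f M) x₀) (hcrit : fderiv ℝ (smoothExt f M) x₀ = 0)
    {γ γ' : ℝ} (hγ : γ' < γ) (hgrow : ∀ᶠ p in 𝓝[M] x₀, γ / 2 * ‖p - x₀‖ ^ 2 ≤ f p - f x₀) :
    ∀ᶠ p in 𝓝[M] x₀, γ' * ‖p - x₀‖ ≤ ‖covGrad f M p‖ := by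
  have htaylor := eventually_sub_le_half_fderiv_add
    (eventually_differentiableAt_of_contDiffAt two_ne_zero hsmooth) hcrit
    ((hsmooth.fderiv_right (m := 1) (by norm_num)).differentiableAt (by norm_num))
    (half_pos (sub_pos.2 hγ))
  filter_upwards [hgrow, mem_nhdsWithin_of_mem_nhds htaylor, self_mem_nhdsWithin]
    with p hp hpt hpM
  rw [smoothExt_eq_self_of_mem hpM, smoothExt_eq_self_of_mem hM, ← inner_gradient_left] at hpt
  have hcs : inner ℝ (gradient (smoothExt f M) p) (p - x₀) ≤ ‖covGrad f M p‖ * ‖p - x₀‖ :=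
    real_inner_le_norm _ _
  rcases (norm_nonneg (p - x₀)).eq_or_lt' with hzero | hpos
  · simp [hzero]
  · exact le_of_mul_le_mul_right (by linarith) hpos

lemma eventually_sub_le_constBeta_mul_sq (hM : x₀ ∈ M)
    (hsmooth : ContDiffAt ℝ 2 (smoothExt f M) x₀) (hcrit : fderiv ℝ (smoothExt f M) x₀ = 0)
    {γ : ℝ} (hγ : 0 < γ) (hgrow : ∀ᶠ p in 𝓝[M] x₀, γ / 2 * ‖p - x₀‖ ^ 2 ≤ f p - f x₀) :
    ∀ᶠ p in 𝓝[M] x₀, f p - f x₀ ≤ (constBeta f M x₀).toReal / 2 * ‖p - x₀‖ ^ 2 := by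
  have hbound {c : NNReal} {s : Set (Vec d)} (hs : s ∈ 𝓝 x₀)
      (hc : LipschitzOnWith c (fderiv ℝ (smoothExt f M)) s) :
      ∀ᶠ p in 𝓝[M] x₀, f p - f x₀ ≤ c / 2 * ‖p - x₀‖ ^ 2 := by
    filter_upwards [self_mem_nhdsWithin, mem_nhdsWithin_of_mem_nhds (eventually_sub_le_half_mul_sq
      hs (eventually_differentiableAt_of_contDiffAt two_ne_zero hsmooth) hcrit hc)] with p hpM hp
    rwa [smoothExt_eq_self_of_mem hpM, smoothExt_eq_self_of_mem hM] at hp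
  rw [constBeta, lipAt_gradient]
  by_cases hlip : lipAt (fderiv ℝ (smoothExt f M)) x₀ = 0
  · lift γ to NNReal using hγ.le
    obtain ⟨s, hs, hc⟩ := exists_lipschitzOnWith_of_lipAt_lt (c := γ / 2) (by
      rw [hlip]; exact_mod_cast half_pos (NNReal.coe_pos.1 hγ))
    filter_upwards [hgrow, hbound hs hc] with p hp hpc
    have hsq : (γ : ℝ) / 4 * ‖p - x₀‖ ^ 2 ≤ 0 := by
      rw [NNReal.coe_div, NNReal.coe_ofNat] at hpc
      linarith
    have hzero : ‖p - x₀‖ = 0 :=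
      pow_eq_zero_iff two_ne_zero |>.1 ((nonpos_of_mul_nonpos_right hsq (by positivity)).antisymm
        (sq_nonneg _))
    simpa [hlip, hzero] using hpc
  · obtain ⟨s, hs, hc⟩ := exists_lipschitzOnWith_two_mul_lipAt hlip
      (lipAt_ne_top_of_contDiffAt (hsmooth.fderiv_right (by norm_num)))
    exact hbound hs hc

end SmoothExtension

section Sharpness

variable {d : ℕ} {f : Vec d → ℝ} {M s : Set (Vec d)} {x₀ : Vec d} {K : NNReal}

lemma mem_nhds_of_lipAt_lt_liminf
    (h : lipAt f x₀ < liminf (fun x => infEDist 0 (clarkeSubdiff f x)) (𝓝[Mᶜ] x₀)) :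
    M ∈ 𝓝 x₀ := by
  obtain ⟨c, hlip, hslope⟩ := ENNReal.lt_iff_exists_nnreal_btwn.1 h
  obtain ⟨s, hs, hf⟩ := exists_lipschitzOnWith_of_lipAt_lt hlip
  filter_upwards [eventually_mem_nhds_iff.2 hs,
    eventually_nhdsWithin_iff.1 (eventually_lt_of_lt_liminf hslope)] with x hxs hx
  by_contra hxM
  obtain ⟨v, hv⟩ := clarkeSubdiff_nonempty hxs hf
  refine (hx hxM).not_ge ((infEDist_le_edist_of_mem hv).trans ?_)
  rw [edist_zero_left]
  exact_mod_cast norm_le_of_mem_clarkeSubdiff hxs hf hv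

lemma exists_lipschitzOnWith_inter (hsmooth : ContDiffAt ℝ 1 (smoothExt f M) x₀)
    (hcrit : fderiv ℝ (smoothExt f M) x₀ = 0) {ε : NNReal} (hε : 0 < ε) :
    ∃ s ∈ 𝓝 x₀, LipschitzOnWith ε f (M ∩ s) := by
  have hstrict : HasStrictFDerivAt (smoothExt f M) (0 : Vec d →L[ℝ] ℝ) x₀ :=
    hcrit ▸ hsmooth.hasStrictFDerivAt one_ne_zero
  obtain ⟨s, hs, hlip⟩ := hstrict.exists_lipschitzOnWith_of_nnnorm_lt ε (by simpa using hε)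
  refine ⟨s, hs, fun p hp q hq => ?_⟩
  simpa only [smoothExt_eq_self_of_mem hp.1, smoothExt_eq_self_of_mem hq.1] using hlip hp.2 hq.2

-- A minimizer `z` of `f + κ ‖· - y‖` near `x₀` lies on `M`: off `M`, the Fermat rule would produce
-- a Clarke subgradient of norm at most `κ`.
lemma eventually_exists_mem_add_mul_norm_le (hs : s ∈ 𝓝 x₀) (hf : LipschitzOnWith K f s)
    (hmin : IsLocalMin f x₀) {κ : ℝ} (hκ : 0 < κ)
    (hslope : ∀ᶠ x in 𝓝[Mᶜ] x₀, ENNReal.ofReal κ < infEDist 0 (clarkeSubdiff f x))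
    {N : Set (Vec d)} (hN : N ∈ 𝓝 x₀) :
    ∀ᶠ y in 𝓝 x₀, ∃ z ∈ M ∩ N, f z + κ * ‖z - y‖ ≤ f y := by
  obtain ⟨r, hr, hball⟩ := nhds_basis_closedBall.eventually_iff.1
    ((eventually_nhdsWithin_iff.1 hslope).and (hmin.and
      ((eventually_mem_nhds_iff.2 hs).and hN)))
  have hcont : ContinuousAt f x₀ := hf.continuousOn.continuousAt hs
  have hsmall : ∀ᶠ y in 𝓝 x₀, f y < f x₀ + κ * (r / 2) :=
    hcont.eventually (gt_mem_nhds (lt_add_of_pos_right _ (by positivity)))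
  filter_upwards [hsmall, ball_mem_nhds x₀ (half_pos hr)] with y hfy hy
  rw [mem_ball_iff_norm] at hy
  have hfc : ContinuousOn f (closedBall x₀ r) :=
    hf.continuousOn.mono fun z hz => mem_of_mem_nhds (hball hz).2.2.1
  obtain ⟨z, hz, hzmin⟩ := (isCompact_closedBall x₀ r).exists_isMinOn
    ⟨x₀, mem_closedBall_self hr.le⟩
    (hfc.add (continuousOn_const.mul (continuous_id.sub continuous_const).norm.continuousOn)
      : ContinuousOn (fun z => f z + κ * ‖z - y‖) (closedBall x₀ r))
  have hzy : f z + κ * ‖z - y‖ ≤ f y := by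
    simpa using hzmin (mem_closedBall_iff_norm.2 (by linarith : ‖y - x₀‖ ≤ r))
  obtain ⟨hzslope, hzx₀, hzs, hzN⟩ := hball hz
  have hzball : ‖z - x₀‖ < r := by
    have hzy' : ‖z - y‖ < r / 2 := lt_of_mul_lt_mul_left (by linarith) hκ.le
    linarith [norm_sub_le_norm_sub_add_norm_sub z y x₀]
  refine ⟨z, ⟨?_, hzN⟩, hzy⟩
  by_contra hzM
  refine (hzslope hzM).not_ge (infEDist_clarkeSubdiff_le_of_isLocalMin hzs hf hκ.le ?_)
  filter_upwards [isOpen_ball.mem_nhds (mem_ball_iff_norm.2 hzball)] with w hw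
  have hzw : f z + κ * ‖z - y‖ ≤ f w + κ * ‖w - y‖ := hzmin (ball_subset_closedBall hw)
  have htri := mul_le_mul_of_nonneg_left (norm_sub_le_norm_sub_add_norm_sub w z y) hκ.le
  simp only [sub_self, norm_zero, mul_zero, add_zero]
  linarith

lemma eventually_proj_add_mul_infDist_le (hM : x₀ ∈ M)
    (hproj : ∀ᶠ x in 𝓝 x₀, proj M x ∈ projSet M x) (hs : s ∈ 𝓝 x₀)
    (hf : LipschitzOnWith K f s) (hmin : IsLocalMin f x₀)
    (hflat : ∀ ε : NNReal, 0 < ε → ∃ t ∈ 𝓝 x₀, LipschitzOnWith ε f (M ∩ t)) {κ κ' : ℝ}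
    (hκ' : 0 ≤ κ') (hκ : κ' < κ)
    (hslope : ∀ᶠ x in 𝓝[Mᶜ] x₀, ENNReal.ofReal κ < infEDist 0 (clarkeSubdiff f x)) :
    ∀ᶠ y in 𝓝 x₀, f (proj M y) + κ' * infDist y M ≤ f y := by
  obtain ⟨ε, hε⟩ : ∃ ε : NNReal, (ε : ℝ) = (κ - κ') / 2 :=
    CanLift.prf ((κ - κ') / 2) (half_pos (sub_pos.2 hκ)).le
  obtain ⟨t, ht, hlip⟩ := hflat ε (NNReal.coe_pos.1 (hε ▸ half_pos (sub_pos.2 hκ)))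
  filter_upwards [eventually_exists_mem_add_mul_norm_le hs hf hmin (hκ'.trans_lt hκ) hslope ht,
    hproj, (tendsto_proj hM hproj).eventually ht] with y ⟨z, hz, hzy⟩ hp hpt
  have hpz : ‖proj M y - z‖ ≤ 2 * ‖z - y‖ := by
    simpa only [norm_sub_rev y z] using norm_sub_le_of_mem_projSet hz.1 hp
  have hfpz : f (proj M y) - f z ≤ (κ - κ') / 2 * ‖proj M y - z‖ := by
    rw [← hε, ← dist_eq_norm]
    exact (le_abs_self _).trans (hlip.dist_le_mul _ ⟨hp.1, hpt⟩ _ hz)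
  have hdist : infDist y M ≤ ‖z - y‖ := by
    simpa only [dist_eq_norm, norm_sub_rev y z] using infDist_le_dist_of_mem (x := y) hz.1
  calc f (proj M y) + κ' * infDist y M
      ≤ f z + (κ - κ') / 2 * (2 * ‖z - y‖) + κ' * ‖z - y‖ := by
        have := mul_le_mul_of_nonneg_left hpz (half_pos (sub_pos.2 hκ)).le
        have := mul_le_mul_of_nonneg_left hdist hκ'
        linarith
    _ = f z + κ * ‖z - y‖ := by ring
    _ ≤ f y := hzy

end Sharpness

section Goldstein

variable {d : ℕ} {f : Vec d → ℝ} {x w : Vec d} {σ c : ℝ}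

lemma clarkeSubdiff_subset_goldsteinSubdiff {y : Vec d} (hy : y ∈ closedBall x σ) :
    clarkeSubdiff f y ⊆ goldsteinSubdiff σ f x :=
  (Set.subset_biUnion_of_mem (u := clarkeSubdiff f) hy).trans (subset_convexHull ℝ _)

lemma goldsteinSubdiff_nonempty {K : NNReal} {s : Set (Vec d)} (hs : s ∈ 𝓝 x)
    (hf : LipschitzOnWith K f s) (hσ : 0 ≤ σ) : (goldsteinSubdiff σ f x).Nonempty :=
  (clarkeSubdiff_nonempty hs hf).mono
    (clarkeSubdiff_subset_goldsteinSubdiff (mem_closedBall_self hσ))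

lemma le_infDist_goldsteinSubdiff (hne : (goldsteinSubdiff σ f x).Nonempty) (hw : w ≠ 0)
    (hc : ∀ y ∈ closedBall x σ, ∀ v ∈ clarkeSubdiff f y, c * ‖w‖ ≤ inner ℝ w v) :
    c ≤ infDist 0 (goldsteinSubdiff σ f x) := by
  have hsub : goldsteinSubdiff σ f x ⊆ {v | c * ‖w‖ ≤ inner ℝ w v} :=
    convexHull_min (Set.iUnion₂_subset hc)
      (convex_halfSpace_ge (innerSL ℝ w).toLinearMap.isLinear _)
  refine (le_infDist hne).2 fun g hg => ?_
  rw [dist_zero_left]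
  refine le_of_mul_le_mul_right ((hsub hg).trans ?_) (norm_pos_iff.2 hw)
  rw [mul_comm]
  exact real_inner_le_norm w g

end Goldstein

/-- The strong (a) condition with constant `C` along the manifold `M` described by `φ`: near `x₀`,
the tangential part of a Clarke subgradient at `x` is within `C ‖x - y‖` of the covariant gradient
at `y ∈ M`. -/
def IsStrongARegular {d p : ℕ} (f : Vec d → ℝ) {M : Set (Vec d)} {x₀ : Vec d}
    (φ : LocalDefiningMap p M x₀) (C : ℝ) : Prop :=
  ∀ᶠ q : Vec d × Vec d in 𝓝 (x₀, x₀), q.2 ∈ M → ∀ v ∈ clarkeSubdiff f q.1,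
    ‖(φ.tangentSpace q.2).starProjection (v - covGrad f M q.2)‖ ≤ C * ‖q.1 - q.2‖

/-- (b)-regularity of `f` along `M` at `x₀`: near `x₀`, a Clarke subgradient at `x` supports `f` at
the points `y` of `M` up to an error `o(‖y - x‖)`, here in its `ε`-form. -/
def IsBRegularAlong {d : ℕ} (f : Vec d → ℝ) (M : Set (Vec d)) (x₀ : Vec d) : Prop :=
  ∀ ε > 0, ∀ᶠ q : Vec d × Vec d in 𝓝 (x₀, x₀), q.2 ∈ M → ∀ v ∈ clarkeSubdiff f q.1,
    f q.1 + inner ℝ v (q.2 - q.1) ≤ f q.2 + ε * ‖q.2 - q.1‖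

lemma eventually_forall_mem_closedBall_norm_sub {E : Type*} [SeminormedAddCommGroup E] {x₀ : E}
    {P : E × E → Prop} (hP : ∀ᶠ q in 𝓝 (x₀, x₀), P q) :
    ∀ᶠ x in 𝓝 x₀, ∀ y ∈ closedBall x ‖x - x₀‖, ∀ z ∈ closedBall x ‖x - x₀‖, P (y, z) := by
  obtain ⟨r, hr, hball⟩ := eventually_nhds_iff_ball.1 hP
  filter_upwards [ball_mem_nhds x₀ (half_pos hr)] with x hx y hy z hz
  have hnear {u : E} (hu : u ∈ closedBall x ‖x - x₀‖) : dist u x₀ < r := by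
    rw [mem_closedBall, ← dist_eq_norm] at hu
    linarith [dist_triangle u x x₀, mem_ball.1 hx]
  exact hball _ (max_lt (hnear hy) (hnear hz))

lemma sq_norm_sub_mul_le_inner_of_mem {E : Type*} [NormedAddCommGroup E] [InnerProductSpace ℝ E]
    {T : Submodule ℝ E} [T.HasOrthogonalProjection] {w : E} (hw : w ∈ T) (v : E) :
    ‖w‖ ^ 2 - ‖w‖ * ‖T.starProjection (v - w)‖ ≤ inner ℝ w v := by
  have hself : inner ℝ w (v - w) = inner ℝ w (T.starProjection (v - w)) := by
    rw [← Submodule.inner_starProjection_left_eq_right, Submodule.starProjection_eq_self_iff.2 hw]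
  have hcs := neg_le_of_abs_le (abs_real_inner_le_norm w (T.starProjection (v - w)))
  rw [← hself, inner_sub_right, real_inner_self_eq_norm_sq] at hcs
  linarith

section SubgradientBounds

variable {d k : ℕ} {f : Vec d → ℝ} {M s : Set (Vec d)} {x₀ : Vec d} {K : NNReal}
variable {φ : LocalDefiningMap k M x₀}

lemma isBRegularAlong_of_tendsto {o : ℝ → ℝ} (ho : Tendsto (fun t => o t / t) (𝓝[≠] 0) (𝓝 0))
    (hb : ∀ᶠ q : Vec d × Vec d in 𝓝 (x₀, x₀), q.2 ∈ M → ∀ v ∈ clarkeSubdiff f q.1,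
      f q.1 + inner ℝ v (q.2 - q.1) + o ‖q.2 - q.1‖ ≤ f q.2) : IsBRegularAlong f M x₀ := by
  intro ε hε
  have hnorm : Tendsto (fun q : Vec d × Vec d => ‖q.2 - q.1‖) (𝓝 (x₀, x₀)) (𝓝 0) :=
    Continuous.tendsto' (by fun_prop) _ _ (by simp)
  filter_upwards [hb, hnorm.eventually (eventually_nhdsWithin_iff.1
    (ho.eventually (lt_mem_nhds (neg_lt_zero.2 hε))))] with q hq hqo hqM v hv
  rcases eq_or_ne ‖q.2 - q.1‖ 0 with hzero | hne
  · have heq : q.2 = q.1 := sub_eq_zero.1 (norm_eq_zero.1 hzero)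
    simp [heq]
  · have hlower := (lt_div_iff₀ ((norm_nonneg _).lt_of_ne' hne)).1 (hqo hne)
    linarith [hq hqM v hv]

lemma eventually_mul_infDist_sub_le_inner (hproj : ∀ᶠ x in 𝓝 x₀, proj M x ∈ projSet M x)
    (hM : x₀ ∈ M) (hflat : ∀ ε : NNReal, 0 < ε → ∃ t ∈ 𝓝 x₀, LipschitzOnWith ε f (M ∩ t))
    (hb : IsBRegularAlong f M x₀) {κ : ℝ}
    (hsharp : ∀ᶠ y in 𝓝 x₀, f (proj M y) + κ * infDist y M ≤ f y) {ε : NNReal} (hε : 0 < ε) :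
    ∀ᶠ q : Vec d × Vec d in 𝓝 (x₀, x₀), q.2 ∈ M → ∀ v ∈ clarkeSubdiff f q.1,
      κ * infDist q.1 M - 3 * ε * ‖q.1 - q.2‖ ≤ inner ℝ v (q.1 - q.2) := by
  obtain ⟨t, ht, hlip⟩ := hflat ε hε
  have hproj_t := (tendsto_proj hM hproj).eventually ht
  filter_upwards [hb ε hε, hsharp.prod_inl_nhds x₀, hproj.prod_inl_nhds x₀,
    hproj_t.prod_inl_nhds x₀, (eventually_mem_set.2 ht).prod_inr_nhds x₀]
    with ⟨y, p⟩ hbq hsharpy hpy hpyt hpt hpM v hv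
  have hsupp := hbq hpM v hv
  have hflatp : f p - f (proj M y) ≤ ε * (2 * ‖y - p‖) :=
    calc f p - f (proj M y) ≤ ε * dist p (proj M y) :=
          (le_abs_self _).trans (hlip.dist_le_mul _ ⟨hpM, hpt⟩ _ ⟨hpy.1, hpyt⟩)
      _ ≤ ε * (2 * ‖y - p‖) := by
          rw [dist_comm, dist_eq_norm]
          exact mul_le_mul_of_nonneg_left (norm_sub_le_of_mem_projSet hpM hpy) ε.2
  simp only at hsupp hsharpy ⊢
  rw [← neg_sub y p, inner_neg_right, norm_neg] at hsupp
  linarith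

lemma eventually_half_le_infDist_goldsteinSubdiff (hM : x₀ ∈ M)
    (hproj : ∀ᶠ x in 𝓝 x₀, proj M x ∈ projSet M x) (hs : s ∈ 𝓝 x₀)
    (hf : LipschitzOnWith K f s) {m : ℝ} (hm : 0 ≤ m)
    (hinner : ∀ᶠ q : Vec d × Vec d in 𝓝 (x₀, x₀), q.2 ∈ M → ∀ v ∈ clarkeSubdiff f q.1,
      m * infDist q.1 M - m / 9 * ‖q.1 - q.2‖ ≤ inner ℝ v (q.1 - q.2)) :
    ∀ᶠ x in 𝓝 x₀, ∀ σ, 0 < σ → 8 * σ ≤ infDist x M → 8 * K * σ ≤ m * infDist x M →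
      m / 2 ≤ infDist 0 (goldsteinSubdiff σ f x) := by
  filter_upwards [eventually_forall_mem_closedBall_norm_sub
    (hinner.and ((eventually_mem_nhds_iff.2 hs).prod_inl_nhds x₀)), hproj,
    eventually_mem_nhds_iff.2 hs] with x hnear hp hsx σ hσ hσD hKσ
  have hDp := infDist_eq_of_mem_projSet hp
  have hDx : infDist x M ≤ ‖x - x₀‖ := dist_eq_norm x x₀ ▸ infDist_le_dist_of_mem hM
  have hpx : proj M x ∈ closedBall x ‖x - x₀‖ := by
    rwa [mem_closedBall_iff_norm', ← hDp]
  refine le_infDist_goldsteinSubdiff (w := x - proj M x) (goldsteinSubdiff_nonempty hsx hf hσ.le)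
    (norm_pos_iff.1 (by linarith)) fun y hy v hv => ?_
  obtain ⟨hyp, hsy⟩ := hnear y (closedBall_subset_closedBall (by linarith) hy) _ hpx
  rw [mem_closedBall_iff_norm'] at hy
  have hDy : infDist x M ≤ infDist y M + ‖x - y‖ := by
    rw [← dist_eq_norm]
    exact infDist_le_infDist_add_dist
  have hyp' : ‖y - proj M x‖ ≤ ‖x - y‖ + infDist x M := by
    rw [hDp, norm_sub_rev x y]
    exact norm_sub_le_norm_sub_add_norm_sub y x _
  have hvxy : -(K * σ) ≤ inner ℝ v (x - y) := by
    refine neg_le_of_abs_le ((abs_real_inner_le_norm v (x - y)).trans ?_)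
    exact mul_le_mul (norm_le_of_mem_clarkeSubdiff hsy hf hv) hy (norm_nonneg _) K.2
  have hsplit : inner ℝ (x - proj M x) v = inner ℝ v (y - proj M x) + inner ℝ v (x - y) := by
    rw [real_inner_comm, ← inner_add_right, add_comm, sub_add_sub_cancel]
  have hmDy : m * (infDist x M - infDist x M / 8) ≤ m * infDist y M :=
    mul_le_mul_of_nonneg_left (by linarith) hm
  have hmyp : m / 9 * ‖y - proj M x‖ ≤ m / 9 * (infDist x M / 8 + infDist x M) :=
    mul_le_mul_of_nonneg_left (by linarith) (by positivity)
  rw [← hDp, hsplit]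
  linarith [hyp hp.1 v hv, mul_nonneg hm (infDist_nonneg (x := x) (s := M))]

lemma eventually_mul_norm_proj_sub_le_infDist_goldsteinSubdiff (hM : x₀ ∈ M)
    (hproj : ∀ᶠ x in 𝓝 x₀, proj M x ∈ projSet M x) (hs : s ∈ 𝓝 x₀) (hf : LipschitzOnWith K f s)
    (htan : ∀ᶠ p in 𝓝 x₀, p ∈ M → covGrad f M p ∈ φ.tangentSpace p) {γ C : ℝ} (hγ : 0 < γ)
    (hC : 0 ≤ C) (hcov : ∀ᶠ p in 𝓝[M] x₀, γ / 2 * ‖p - x₀‖ ≤ ‖covGrad f M p‖)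
    (hstrong : IsStrongARegular f φ C) :
    ∀ᶠ x in 𝓝 x₀, ∀ σ a : ℝ, 0 < σ → a ≤ 1 / 2 → a * (8 * C) ≤ γ → σ ≤ a * ‖proj M x - x₀‖ →
      infDist x M ≤ a * ‖proj M x - x₀‖ →
      γ / 4 * ‖proj M x - x₀‖ ≤ infDist 0 (goldsteinSubdiff σ f x) := by
  have htendsto := tendsto_proj hM hproj
  filter_upwards [eventually_forall_mem_closedBall_norm_sub hstrong, hproj,
    eventually_mem_nhds_iff.2 hs, htendsto.eventually htan,
    htendsto.eventually (eventually_nhdsWithin_iff.1 hcov)]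
    with x hnear hp hsx htanp hcovp σ a hσ ha haC hσn hDn
  have htanp := htanp hp.1
  have hcovp := hcovp hp.1
  have hpx := norm_sub_le_of_mem_projSet hM hp
  have hDp := infDist_eq_of_mem_projSet hp
  set p := proj M x
  set w := covGrad f M p
  have hn : 0 < ‖p - x₀‖ := (norm_nonneg _).lt_of_ne' fun h => by
    rw [h, mul_zero] at hσn
    exact hσn.not_gt hσ
  have han : a * ‖p - x₀‖ ≤ ‖x - x₀‖ := by
    linarith [mul_le_mul_of_nonneg_right ha hn.le]
  have hw : 0 < ‖w‖ := lt_of_lt_of_le (by positivity) hcovp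
  refine le_infDist_goldsteinSubdiff (goldsteinSubdiff_nonempty hsx hf hσ.le)
    (norm_pos_iff.1 hw) fun y hy v hv => ?_
  have hstrongy := hnear y (closedBall_subset_closedBall (hσn.trans han) hy) p
    (mem_closedBall_iff_norm'.2 (by linarith)) hp.1 v hv
  have hyp : ‖y - p‖ ≤ 2 * (a * ‖p - x₀‖) := by
    linarith [norm_sub_le_norm_sub_add_norm_sub y x p, mem_closedBall_iff_norm.1 hy]
  have htangential : ‖(φ.tangentSpace p).starProjection (v - w)‖ ≤ γ / 4 * ‖p - x₀‖ := by
    refine hstrongy.trans ((mul_le_mul_of_nonneg_left hyp hC).trans ?_)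
    linarith [mul_le_mul_of_nonneg_right haC hn.le]
  calc γ / 4 * ‖p - x₀‖ * ‖w‖ ≤ (‖w‖ - ‖(φ.tangentSpace p).starProjection (v - w)‖) * ‖w‖ :=
        mul_le_mul_of_nonneg_right (by linarith) hw.le
    _ = ‖w‖ ^ 2 - ‖w‖ * ‖(φ.tangentSpace p).starProjection (v - w)‖ := by ring
    _ ≤ inner ℝ w v := sq_norm_sub_mul_le_inner_of_mem htanp v

end SubgradientBounds

section Constants

variable {d k : ℕ} {f : Vec d → ℝ} {M s : Set (Vec d)} {x₀ : Vec d} {K : NNReal}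
variable {φ : LocalDefiningMap k M x₀} {γ Ca : ℝ}

lemma constL_ne_top (hs : s ∈ 𝓝 x₀) (hf : LipschitzOnWith K f s) : constL f x₀ ≠ ∞ :=
  ENNReal.mul_ne_top ENNReal.ofNat_ne_top
    ((lipAt_le_of_lipschitzOnWith hs hf).trans_lt ENNReal.coe_lt_top).ne

lemma constBeta_ne_top (hsmooth : ContDiffAt ℝ 2 (smoothExt f M) x₀) : constBeta f M x₀ ≠ ∞ := by
  rw [constBeta, lipAt_gradient]
  exact ENNReal.mul_ne_top ENNReal.ofNat_ne_top
    (lipAt_ne_top_of_contDiffAt (hsmooth.fderiv_right (by norm_num)))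

lemma constCM_ne_top (hproj : ContDiffAt ℝ 2 (proj M) x₀) : constCM M x₀ ≠ ∞ :=
  ENNReal.mul_ne_top ENNReal.ofNat_ne_top
    (lipAt_ne_top_of_contDiffAt (hproj.fderiv_right (by norm_num)))

lemma liminf_infEDist_clarkeSubdiff_eq :
    liminf (fun x => infEDist 0 (clarkeSubdiff f x)) (𝓝[Mᶜ] x₀) = 4 * constMu f M x₀ := by
  rw [constMu, ENNReal.mul_div_cancel (by norm_num) (by norm_num)]

lemma constMu_pos (hA : IsActiveManifold f φ) : 0 < constMu f M x₀ := by
  obtain ⟨U, hU, c, hc, hsharp⟩ := hA.sharp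
  refine ENNReal.div_pos ((ENNReal.ofReal_pos.2 hc).trans_le
    (le_liminf_of_le (h := ?_))).ne' (by norm_num)
  filter_upwards [self_mem_nhdsWithin, mem_nhdsWithin_of_mem_nhds hU] with x hxM hxU
  refine le_infEDist.2 fun v hv => ?_
  rw [edist_dist, dist_zero_left]
  exact ENNReal.ofReal_le_ofReal (hsharp x ⟨hxU, hxM⟩ v hv)

lemma mem_nhds_of_lipAt_eq_zero (hμ : 0 < constMu f M x₀) (hlip : lipAt f x₀ = 0) : M ∈ 𝓝 x₀ := by
  refine mem_nhds_of_lipAt_lt_liminf (f := f) ?_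
  rw [hlip, liminf_infEDist_clarkeSubdiff_eq]
  exact ENNReal.mul_pos (by norm_num) hμ.ne'

lemma mem_nhds_of_constMu_eq_top (hs : s ∈ 𝓝 x₀) (hf : LipschitzOnWith K f s)
    (hμ : constMu f M x₀ = ∞) : M ∈ 𝓝 x₀ := by
  refine mem_nhds_of_lipAt_lt_liminf (f := f) ?_
  rw [liminf_infEDist_clarkeSubdiff_eq, hμ, ENNReal.mul_top (by norm_num)]
  exact (lipAt_le_of_lipschitzOnWith hs hf).trans_lt ENNReal.coe_lt_top

lemma constD1_pos (hμ : 0 < constMu f M x₀) (hL : constL f x₀ ≠ ∞) : 0 < constD1 f M x₀ := by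
  unfold constD1
  split_ifs with htop
  · norm_num
  · exact ENNReal.div_pos hμ.ne' (by finiteness)

lemma constC2_pos {δ : ℝ} (hγ : 0 < γ) (hCa : 0 < Ca) (hδ : 0 < δ) : 0 < constC2 γ Ca δ := by
  unfold constC2
  positivity

lemma deltaGI_pos {δ : ℝ} (hD : 0 < constD1 f M x₀) (hCM : constCM M x₀ ≠ ∞) (hδ : 0 < δ) :
    0 < deltaGI f M x₀ δ :=
  lt_min (ENNReal.ofReal_pos.2 (by positivity)) (ENNReal.div_pos hD.ne' hCM)

lemma constEta_pos (hμ : 0 < constMu f M x₀) (hL : constL f x₀ ≠ ∞) (hβ : constBeta f M x₀ ≠ ∞)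
    (hγ : 0 < γ) {a₁ a₂ : ℝ} (h₁ : 0 < a₁) (h₂ : 0 < a₂) : 0 < constEta f M x₀ γ a₁ a₂ := by
  have h₂' : ENNReal.ofReal (a₂ ^ 2) ≠ 0 := (ENNReal.ofReal_pos.2 (by positivity)).ne'
  refine lt_min (ENNReal.div_pos (ENNReal.ofReal_pos.2 (by positivity)).ne' ?_)
    (ENNReal.div_pos (mul_ne_zero hμ.ne' (ENNReal.ofReal_pos.2 h₁).ne') ?_)
  · finiteness
  · finiteness

end Constants

section GradientInequality

variable {d k : ℕ} {f : Vec d → ℝ} {M s : Set (Vec d)} {x₀ : Vec d} {K : NNReal}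
variable {φ : LocalDefiningMap k M x₀} {γ a₁ a₂ : ℝ}

lemma eventually_sub_proj_le_constL_mul_infDist (hM : x₀ ∈ M)
    (hproj : ∀ᶠ x in 𝓝 x₀, proj M x ∈ projSet M x) (hs : s ∈ 𝓝 x₀) (hf : LipschitzOnWith K f s)
    (hμ : 0 < constMu f M x₀) :
    ∀ᶠ x in 𝓝 x₀, f x - f (proj M x) ≤ (constL f x₀).toReal * infDist x M := by
  by_cases hlip : lipAt f x₀ = 0
  · filter_upwards [mem_nhds_of_lipAt_eq_zero hμ hlip] with x hx
    simp [proj_eq_self_of_mem hx, constL, hlip]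
  · obtain ⟨t, ht, hft⟩ := exists_lipschitzOnWith_two_mul_lipAt hlip
      ((lipAt_le_of_lipschitzOnWith hs hf).trans_lt ENNReal.coe_lt_top).ne
    filter_upwards [hproj, ht, (tendsto_proj hM hproj).eventually ht] with x hp hx hpx
    rw [infDist_eq_of_mem_projSet hp, ← dist_eq_norm]
    exact (le_abs_self _).trans (hft.dist_le_mul _ hx _ hpx)

lemma eventually_sub_le_add (hM : x₀ ∈ M) (hproj : ∀ᶠ x in 𝓝 x₀, proj M x ∈ projSet M x)
    (hs : s ∈ 𝓝 x₀) (hf : LipschitzOnWith K f s) (hμ : 0 < constMu f M x₀)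
    (hβ : ∀ᶠ p in 𝓝[M] x₀, f p - f x₀ ≤ (constBeta f M x₀).toReal / 2 * ‖p - x₀‖ ^ 2) :
    ∀ᶠ x in 𝓝 x₀, f x - f x₀ ≤ (constL f x₀).toReal * infDist x M +
      (constBeta f M x₀).toReal / 2 * ‖proj M x - x₀‖ ^ 2 := by
  filter_upwards [eventually_sub_proj_le_constL_mul_infDist hM hproj hs hf hμ, hproj,
    (tendsto_proj hM hproj).eventually (eventually_nhdsWithin_iff.1 hβ)] with x hnormal hp htan
  linarith [htan hp.1]

lemma mul_constMu_add_constL_le (hμ : constMu f M x₀ ≠ ∞) (hμ₀ : 0 < constMu f M x₀)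
    (hL : constL f x₀ ≠ ∞) (ha₁ : ENNReal.ofReal a₁ ≤ constD1 f M x₀) :
    a₁ * (8 * ((constMu f M x₀).toReal + (constL f x₀).toReal)) ≤ (constMu f M x₀).toReal := by
  have hpos := ENNReal.toReal_pos hμ₀.ne' hμ
  have hL₀ := (constL f x₀).toReal_nonneg
  rw [constD1, if_neg hμ] at ha₁
  have hreal := (ENNReal.ofReal_le_iff_le_toReal (by finiteness)).1 ha₁
  rw [ENNReal.toReal_div, ENNReal.toReal_mul, ENNReal.toReal_add hμ hL,
    ENNReal.toReal_ofNat] at hreal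
  exact (le_div_iff₀ (by positivity)).1 hreal

lemma eventually_half_le_infDist_goldsteinSubdiff_of_slope (hM : x₀ ∈ M)
    (hproj : ∀ᶠ x in 𝓝 x₀, proj M x ∈ projSet M x) (hs : s ∈ 𝓝 x₀) (hf : LipschitzOnWith K f s)
    (hmin : IsLocalMin f x₀)
    (hflat : ∀ ε : NNReal, 0 < ε → ∃ t ∈ 𝓝 x₀, LipschitzOnWith ε f (M ∩ t))
    (hb : IsBRegularAlong f M x₀) {m : NNReal} (hm : 0 < m) {κ : ℝ} (hκ : m < κ)
    (hslope : ∀ᶠ x in 𝓝[Mᶜ] x₀, ENNReal.ofReal κ < infEDist 0 (clarkeSubdiff f x)) :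
    ∀ᶠ x in 𝓝 x₀, ∀ σ, 0 < σ → 8 * σ ≤ infDist x M → 8 * K * σ ≤ m * infDist x M →
      m / 2 ≤ infDist 0 (goldsteinSubdiff σ f x) := by
  have hsharp := eventually_proj_add_mul_infDist_le hM hproj hs hf hmin hflat m.coe_nonneg hκ hslope
  refine eventually_half_le_infDist_goldsteinSubdiff hM hproj hs hf m.coe_nonneg ?_
  filter_upwards [eventually_mul_infDist_sub_le_inner hproj hM hflat hb hsharp
    (ε := m / 27) (by positivity)] with q hq hqM v hv
  refine (le_of_eq ?_).trans (hq hqM v hv)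
  rw [NNReal.coe_div, NNReal.coe_ofNat]
  ring

lemma lipAt_lt_constMu_add_constL (hμ : 0 < constMu f M x₀) (hL : constL f x₀ ≠ ∞) :
    lipAt f x₀ < constMu f M x₀ + constL f x₀ :=
  calc lipAt f x₀ ≤ constL f x₀ := by rw [constL, two_mul]; exact le_self_add
    _ < constMu f M x₀ + constL f x₀ := by rw [add_comm]; exact ENNReal.lt_add_right hL hμ.ne'

lemma eventually_constMu_half_le_infDist (hM : x₀ ∈ M)
    (hproj : ∀ᶠ x in 𝓝 x₀, proj M x ∈ projSet M x) (hs : s ∈ 𝓝 x₀) (hf : LipschitzOnWith K f s)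
    (hmin : IsLocalMin f x₀) (hμ : 0 < constMu f M x₀)
    (hflat : ∀ ε : NNReal, 0 < ε → ∃ t ∈ 𝓝 x₀, LipschitzOnWith ε f (M ∩ t))
    (hb : IsBRegularAlong f M x₀) :
    ∀ᶠ x in 𝓝 x₀, ∀ a₁ σ : ℝ, 0 < σ → ENNReal.ofReal a₁ ≤ constD1 f M x₀ →
      σ ≤ a₁ * infDist x M → constMu f M x₀ ≠ ∞ ∧
        (constMu f M x₀).toReal / 2 ≤ infDist 0 (goldsteinSubdiff σ f x) := by
  by_cases htop : constMu f M x₀ = ∞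
  · filter_upwards [mem_nhds_of_constMu_eq_top hs hf htop] with x hx a₁ σ hσ _ hσD
    rw [infDist_zero_of_mem hx, mul_zero] at hσD
    exact absurd hσD hσ.not_ge
  have hL := constL_ne_top hs hf
  have hm : 0 < (constMu f M x₀).toReal := ENNReal.toReal_pos hμ.ne' htop
  obtain ⟨t, ht, hft⟩ := exists_lipschitzOnWith_of_lipAt_lt (F := f) (x₀ := x₀)
    (c := (constMu f M x₀ + constL f x₀).toNNReal) (by
      rw [ENNReal.coe_toNNReal (by finiteness)]
      exact lipAt_lt_constMu_add_constL hμ hL)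
  have hslope : ∀ᶠ x in 𝓝[Mᶜ] x₀,
      ENNReal.ofReal (2 * (constMu f M x₀).toReal) < infEDist 0 (clarkeSubdiff f x) := by
    refine eventually_lt_of_lt_liminf ?_
    rw [liminf_infEDist_clarkeSubdiff_eq, ENNReal.ofReal_mul zero_le_two,
      ENNReal.ofReal_toReal htop, ENNReal.ofReal_ofNat]
    exact ENNReal.mul_lt_mul_left hμ.ne' htop (by norm_num)
  filter_upwards [eventually_half_le_infDist_goldsteinSubdiff_of_slope hM hproj ht hft hmin hflat hb
    (ENNReal.toNNReal_pos hμ.ne' htop) (lt_two_mul_self hm) hslope] with x hx a₁ σ hσ ha₁ hσD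
  have hσ₁ : (8 * ((constMu f M x₀).toReal + (constL f x₀).toReal)) * σ ≤
      (constMu f M x₀).toReal * infDist x M := by
    have ha₁' := mul_constMu_add_constL_le htop hμ hL ha₁
    calc _ ≤ (8 * ((constMu f M x₀).toReal + (constL f x₀).toReal)) * (a₁ * infDist x M) :=
          mul_le_mul_of_nonneg_left hσD (by positivity)
      _ = a₁ * (8 * ((constMu f M x₀).toReal + (constL f x₀).toReal)) * infDist x M := by ring
      _ ≤ _ := mul_le_mul_of_nonneg_right ha₁' infDist_nonneg
  refine ⟨htop, hx σ hσ (le_of_mul_le_mul_left ?_ hm) ?_⟩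
  · have hLσ := mul_nonneg (constL f x₀).toReal_nonneg hσ.le
    linarith
  · rwa [ENNReal.coe_toNNReal_eq_toReal, ENNReal.toReal_add htop hL]

lemma mul_ofReal_le_of_le_div {η : ℝ≥0∞} {A B T F R : ℝ} (hA : 0 ≤ A) (hB : 0 ≤ B)
    (hη : η ≤ ENNReal.ofReal A / ENNReal.ofReal B) (hF : F ≤ B * T) (hR : A * T ≤ R) :
    η * ENNReal.ofReal F ≤ ENNReal.ofReal R :=
  calc η * ENNReal.ofReal F
      ≤ ENNReal.ofReal A / ENNReal.ofReal B * (ENNReal.ofReal B * ENNReal.ofReal T) := by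
        rw [← ENNReal.ofReal_mul hB]
        exact mul_le_mul' hη (ENNReal.ofReal_le_ofReal hF)
    _ ≤ ENNReal.ofReal A * ENNReal.ofReal T := by
        rw [← mul_assoc, mul_comm (_ / _)]
        exact mul_le_mul_left ENNReal.mul_div_le _
    _ ≤ ENNReal.ofReal R := by
        rw [← ENNReal.ofReal_mul hA]
        exact ENNReal.ofReal_le_ofReal hR

lemma constEta_le_tangential (hL : constL f x₀ ≠ ∞) (hβ : constBeta f M x₀ ≠ ∞) :
    constEta f M x₀ γ a₁ a₂ ≤ ENNReal.ofReal (γ * a₂) / ENNReal.ofReal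
      (8 * max (4 * (constL f x₀).toReal * a₂ ^ 2) (constBeta f M x₀).toReal) := by
  refine (min_le_left _ _).trans (le_of_eq ?_)
  congr 1
  rw [ENNReal.ofReal_mul (by norm_num), ENNReal.ofReal_max, ENNReal.ofReal_mul (by positivity),
    ENNReal.ofReal_mul (by norm_num), ENNReal.ofReal_toReal hL, ENNReal.ofReal_toReal hβ,
    ENNReal.ofReal_ofNat, ENNReal.ofReal_ofNat]

lemma constEta_le_normal (hL : constL f x₀ ≠ ∞) (hβ : constBeta f M x₀ ≠ ∞)
    (hμ : constMu f M x₀ ≠ ∞) (ha₂ : 0 < a₂) :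
    constEta f M x₀ γ a₁ a₂ ≤ ENNReal.ofReal ((constMu f M x₀).toReal * a₁) / ENNReal.ofReal
      (4 * max (2 * (constL f x₀).toReal) ((constBeta f M x₀).toReal / a₂ ^ 2)) := by
  refine (min_le_right _ _).trans (le_of_eq ?_)
  rw [ENNReal.ofReal_mul (by positivity), ENNReal.ofReal_toReal hμ,
    ENNReal.ofReal_mul (by norm_num), ENNReal.ofReal_max, ENNReal.ofReal_mul (by norm_num),
    ENNReal.ofReal_div_of_pos (by positivity), ENNReal.ofReal_toReal hL, ENNReal.ofReal_toReal hβ,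
    ENNReal.ofReal_ofNat, ENNReal.ofReal_ofNat]

lemma constEta_mul_le_of_infDist_le_sq (hL : constL f x₀ ≠ ∞) (hβ : constBeta f M x₀ ≠ ∞)
    (hγ : 0 ≤ γ) (ha₂ : 0 ≤ a₂) {x : Vec d} {σ g : ℝ} (hσ : 0 ≤ σ)
    (hlow : a₂ / 2 * ‖proj M x - x₀‖ ≤ σ) (hD : infDist x M ≤ 2 * a₂ ^ 2 * ‖proj M x - x₀‖ ^ 2)
    (hup : f x - f x₀ ≤ (constL f x₀).toReal * infDist x M +
      (constBeta f M x₀).toReal / 2 * ‖proj M x - x₀‖ ^ 2)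
    (hg : γ / 4 * ‖proj M x - x₀‖ ≤ g) :
    constEta f M x₀ γ a₁ a₂ * ENNReal.ofReal (f x - f x₀) ≤ ENNReal.ofReal (σ * g) := by
  refine mul_ofReal_le_of_le_div (T := ‖proj M x - x₀‖ ^ 2 / 8) (by positivity) (by positivity)
    (constEta_le_tangential hL hβ) ?_ ?_
  · have hLD := mul_le_mul_of_nonneg_left hD (constL f x₀).toReal_nonneg
    set P := max (4 * (constL f x₀).toReal * a₂ ^ 2) (constBeta f M x₀).toReal
    have hPL : 4 * (constL f x₀).toReal * a₂ ^ 2 * ‖proj M x - x₀‖ ^ 2 ≤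
        P * ‖proj M x - x₀‖ ^ 2 := mul_le_mul_of_nonneg_right (le_max_left _ _) (sq_nonneg _)
    have hPβ : (constBeta f M x₀).toReal * ‖proj M x - x₀‖ ^ 2 ≤
        P * ‖proj M x - x₀‖ ^ 2 := mul_le_mul_of_nonneg_right (le_max_right _ _) (sq_nonneg _)
    linarith
  · linarith [mul_le_mul hlow hg (by positivity) hσ]

lemma constEta_mul_le_of_normalRegion (hL : constL f x₀ ≠ ∞) (hβ : constBeta f M x₀ ≠ ∞)
    (hμ : constMu f M x₀ ≠ ∞) (ha₁ : 0 ≤ a₁) (ha₂ : 0 < a₂) {x : Vec d} {σ g : ℝ} (hσ : 0 ≤ σ)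
    (hreg : NormalRegion M x₀ a₁ a₂ x σ)
    (hup : f x - f x₀ ≤ (constL f x₀).toReal * infDist x M +
      (constBeta f M x₀).toReal / 2 * ‖proj M x - x₀‖ ^ 2)
    (hg : (constMu f M x₀).toReal / 2 ≤ g) :
    constEta f M x₀ γ a₁ a₂ * ENNReal.ofReal (f x - f x₀) ≤ ENNReal.ofReal (σ * g) := by
  obtain ⟨hlow, -, hn⟩ := hreg
  have hD := infDist_nonneg (x := x) (s := M)
  refine mul_ofReal_le_of_le_div (T := infDist x M / 4) (by positivity) (by positivity)
    (constEta_le_normal hL hβ hμ ha₂) ?_ ?_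
  · set P := max (2 * (constL f x₀).toReal) ((constBeta f M x₀).toReal / a₂ ^ 2)
    have hPL : 2 * (constL f x₀).toReal * infDist x M ≤ P * infDist x M :=
      mul_le_mul_of_nonneg_right (le_max_left _ _) hD
    have hPβ : (constBeta f M x₀).toReal * ‖proj M x - x₀‖ ^ 2 ≤ P * infDist x M :=
      calc (constBeta f M x₀).toReal * ‖proj M x - x₀‖ ^ 2
          = (constBeta f M x₀).toReal / a₂ ^ 2 * (a₂ ^ 2 * ‖proj M x - x₀‖ ^ 2) := by field_simp
        _ ≤ P * infDist x M := mul_le_mul (le_max_right _ _) hn (by positivity) (by positivity)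
    linarith
  · linarith [mul_le_mul hlow hg (by positivity) hσ]

lemma exists_normalRegion_or_tangentRegion {x : Vec d} (hp : proj M x ∈ projSet M x) (hx : x ≠ x₀)
    (ha₁ : 0 < a₁) (ha₂ : 0 < a₂) :
    ∃ σ : ℝ, 0 < σ ∧ (NormalRegion M x₀ a₁ a₂ x σ ∨ TangentRegion M x₀ a₂ x σ) := by
  rcases le_or_gt (a₂ ^ 2 * ‖proj M x - x₀‖ ^ 2) (infDist x M) with hnormal | htangent
  · have hD : 0 < infDist x M := by
      refine infDist_nonneg.lt_of_ne' fun hD => hx ?_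
      rw [hD, ← mul_pow] at hnormal
      have hn := pow_eq_zero_iff two_ne_zero |>.1 (hnormal.antisymm (sq_nonneg _))
      rw [infDist_eq_of_mem_projSet hp, norm_sub_eq_zero_iff] at hD
      rw [hD]
      exact norm_sub_eq_zero_iff.1 ((mul_eq_zero.1 hn).resolve_left ha₂.ne')
    have hσ : 0 < a₁ * infDist x M := mul_pos ha₁ hD
    exact ⟨a₁ * infDist x M, hσ, .inl ⟨by linarith, le_rfl, hnormal⟩⟩
  · have hn : 0 < ‖proj M x - x₀‖ := (norm_nonneg _).lt_of_ne' fun hn => by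
      rw [hn] at htangent
      linarith [infDist_nonneg (x := x) (s := M)]
    have hσ : 0 < a₂ * ‖proj M x - x₀‖ := mul_pos ha₂ hn
    refine ⟨a₂ * ‖proj M x - x₀‖, hσ, .inr ⟨by linarith, le_rfl, ?_⟩⟩
    rw [div_le_iff₀ hσ]
    linarith [mul_pos hσ hσ]

lemma eventually_constEta_mul_le_of_normalRegion (hA : IsActiveManifold f φ) (hk : 3 ≤ k)
    (hs : s ∈ 𝓝 x₀) (hf : LipschitzOnWith K f s) (hmin : IsLocalMin f x₀) (hγ : 0 < γ)
    (hgrow : ∀ᶠ p in 𝓝[M] x₀, γ / 2 * ‖p - x₀‖ ^ 2 ≤ f p - f x₀) (hb : IsBRegularAlong f M x₀) :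
    ∀ᶠ x in 𝓝 x₀, ∀ a₁ a₂ σ : ℝ, 0 < a₁ → ENNReal.ofReal a₁ ≤ constD1 f M x₀ → 0 < a₂ → 0 < σ →
      NormalRegion M x₀ a₁ a₂ x σ → constEta f M x₀ γ a₁ a₂ * ENNReal.ofReal (f x - f x₀) ≤
        ENNReal.ofReal (σ * infDist 0 (goldsteinSubdiff σ f x)) := by
  have hproj := φ.eventually_proj_mem hA.mem
  have hsmooth : ContDiffAt ℝ 2 (smoothExt f M) x₀ := contDiffAt_smoothExt hA two_ne_zero hk
  have hcrit := fderiv_smoothExt_eq_zero hA.mem hproj hmin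
  have hflat (ε : NNReal) (hε : 0 < ε) : ∃ t ∈ 𝓝 x₀, LipschitzOnWith ε f (M ∩ t) :=
    exists_lipschitzOnWith_inter (hsmooth.of_le one_le_two) hcrit hε
  filter_upwards [eventually_constMu_half_le_infDist hA.mem hproj hs hf hmin (constMu_pos hA) hflat
      hb, eventually_sub_le_add hA.mem hproj hs hf (constMu_pos hA)
      (eventually_sub_le_constBeta_mul_sq hA.mem hsmooth hcrit hγ hgrow)]
    with x hg hup a₁ a₂ σ ha₁ ha₁' ha₂ hσ hreg
  obtain ⟨hμ, hμg⟩ := hg a₁ σ hσ ha₁' hreg.2.1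
  exact constEta_mul_le_of_normalRegion (constL_ne_top hs hf) (constBeta_ne_top hsmooth) hμ ha₁.le
    ha₂ hσ.le hreg hup hμg

lemma eventually_constEta_mul_le_of_tangentRegion (hA : IsActiveManifold f φ) (hk : 3 ≤ k)
    (hs : s ∈ 𝓝 x₀) (hf : LipschitzOnWith K f s) (hmin : IsLocalMin f x₀) (hγ : 0 < γ)
    (hgrow : ∀ᶠ p in 𝓝[M] x₀, γ / 2 * ‖p - x₀‖ ^ 2 ≤ f p - f x₀) {C : ℝ} (hC : 0 < C)
    (hstrong : IsStrongARegular f φ C) :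
    ∀ᶠ x in 𝓝 x₀, ∀ a₁ a₂ δ σ : ℝ, 0 < a₂ → a₂ ≤ constC2 γ C δ → 0 < σ →
      TangentRegion M x₀ a₂ x σ → constEta f M x₀ γ a₁ a₂ * ENNReal.ofReal (f x - f x₀) ≤
        ENNReal.ofReal (σ * infDist 0 (goldsteinSubdiff σ f x)) := by
  have hproj := φ.eventually_proj_mem hA.mem
  have hsmooth : ContDiffAt ℝ 2 (smoothExt f M) x₀ := contDiffAt_smoothExt hA two_ne_zero hk
  have hcrit := fderiv_smoothExt_eq_zero hA.mem hproj hmin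
  have htan := eventually_covGrad_mem_tangentSpace (φ := φ) (by lia) hA.mem
    (eventually_differentiableAt_of_contDiffAt two_ne_zero hsmooth)
  have hcov := eventually_mul_norm_sub_le_norm_covGrad hA.mem hsmooth hcrit (half_lt_self hγ) hgrow
  filter_upwards [eventually_mul_norm_proj_sub_le_infDist_goldsteinSubdiff hA.mem hproj hs hf htan
      hγ hC.le hcov hstrong, eventually_sub_le_add hA.mem hproj hs hf (constMu_pos hA)
      (eventually_sub_le_constBeta_mul_sq hA.mem hsmooth hcrit hγ hgrow),
      (tendsto_proj hA.mem hproj).eventually (closedBall_mem_nhds x₀ one_pos)]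
    with x hg hup hnear a₁ a₂ δ σ ha₂ ha₂' hσ ⟨hlow, hhigh, hratio⟩
  have ha₂C : a₂ * (8 * C) ≤ γ := (le_div_iff₀ (by positivity)).1 (ha₂'.trans (min_le_left _ _))
  have ha₂half : a₂ ≤ 1 / 2 :=
    (ha₂'.trans (min_le_right _ _)).trans (by gcongr; exact min_le_left _ _)
  rw [dist_eq_norm] at hnear
  have hD : infDist x M ≤ 2 * a₂ ^ 2 * ‖proj M x - x₀‖ ^ 2 :=
    calc infDist x M ≤ 2 * a₂ * ‖proj M x - x₀‖ * σ := (div_le_iff₀ hσ).1 hratio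
      _ ≤ 2 * a₂ * ‖proj M x - x₀‖ * (a₂ * ‖proj M x - x₀‖) := by gcongr
      _ = 2 * a₂ ^ 2 * ‖proj M x - x₀‖ ^ 2 := by ring
  have hDlin : infDist x M ≤ a₂ * ‖proj M x - x₀‖ :=
    calc infDist x M ≤ 2 * a₂ * ‖proj M x - x₀‖ * (a₂ * ‖proj M x - x₀‖) := hD.trans_eq (by ring)
      _ ≤ 2 * (1 / 2) * 1 * (a₂ * ‖proj M x - x₀‖) := by gcongr
      _ = a₂ * ‖proj M x - x₀‖ := by ring
  exact constEta_mul_le_of_infDist_le_sq (constL_ne_top hs hf) (constBeta_ne_top hsmooth) hγ.le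
    ha₂.le hσ.le hlow hD hup (hg σ a₂ hσ ha₂half ha₂C hhigh hDlin)

lemma mem_ball_of_edist_lt_deltaGI {x : Vec d} {δ : ℝ} (hδ : 0 ≤ δ)
    (hx : edist x x₀ < deltaGI f M x₀ δ) : x ∈ ball x₀ δ := by
  have hδx := hx.trans_le (min_le_left _ _)
  rw [edist_dist, ENNReal.ofReal_lt_ofReal_iff_of_nonneg dist_nonneg] at hδx
  exact mem_ball.2 (by linarith)

end GradientInequality

theorem mainTheorem3_general {d k : ℕ} {f : Vec d → ℝ} {M s : Set (Vec d)} {xbar : Vec d}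
    {K : NNReal} {φ : LocalDefiningMap k M xbar} (hk : 3 ≤ k) {γ Ca : ℝ} (hγ : 0 < γ)
    (hCa : 0 < Ca) (hs : s ∈ 𝓝 xbar) (hf : LipschitzOnWith K f s) (hmin : IsLocalMin f xbar)
    (hgrow : ∀ᶠ p in 𝓝[M] xbar, γ / 2 * ‖p - xbar‖ ^ 2 ≤ f p - f xbar)
    (hA : IsActiveManifold f φ) (hstrong : IsStrongARegular f φ Ca)
    (hb : IsBRegularAlong f M xbar) :
    ∃ δ₀ : ℝ, 0 < δ₀ ∧ ∀ δA : ℝ, 0 < δA → δA ≤ δ₀ →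
      0 < constD1 f M xbar ∧ 0 < constC2 γ Ca δA ∧ 0 < deltaGI f M xbar δA ∧
      ∀ a₁ a₂ : ℝ, 0 < a₁ → ENNReal.ofReal a₁ ≤ constD1 f M xbar →
        0 < a₂ → a₂ ≤ constC2 γ Ca δA →
        0 < constEta f M xbar γ a₁ a₂ ∧
        (∀ (x : Vec d) (σ : ℝ), edist x xbar < deltaGI f M xbar δA → 0 < σ →
          (NormalRegion M xbar a₁ a₂ x σ ∨ TangentRegion M xbar a₂ x σ) →
          constEta f M xbar γ a₁ a₂ * ENNReal.ofReal (f x - f xbar) ≤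
            ENNReal.ofReal (σ * Metric.infDist 0 (goldsteinSubdiff σ f x))) ∧
        (∀ x : Vec d, edist x xbar < deltaGI f M xbar δA → x ≠ xbar →
          ∃ σ : ℝ, 0 < σ ∧
            (NormalRegion M xbar a₁ a₂ x σ ∨ TangentRegion M xbar a₂ x σ)) := by
  have hμ := constMu_pos hA
  have hL := constL_ne_top hs hf
  have hβ := constBeta_ne_top (contDiffAt_smoothExt hA two_ne_zero hk)
  have hCM := constCM_ne_top (φ.contDiffAt_proj two_ne_zero hk hA.mem)
  have hD₁ := constD1_pos hμ hL
  obtain ⟨r, hr, hball⟩ := eventually_nhds_iff_ball.1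
    ((eventually_constEta_mul_le_of_normalRegion hA hk hs hf hmin hγ hgrow hb).and
      ((eventually_constEta_mul_le_of_tangentRegion hA hk hs hf hmin hγ hgrow hCa hstrong).and
        (φ.eventually_proj_mem hA.mem)))
  refine ⟨r, hr, fun δA hδ hδr => ⟨hD₁, constC2_pos hγ hCa hδ, deltaGI_pos hD₁ hCM hδ,
    fun a₁ a₂ ha₁ ha₁' ha₂ ha₂' => ⟨constEta_pos hμ hL hβ hγ ha₁ ha₂, ?_⟩⟩⟩
  have hnear (x : Vec d) (hx : edist x xbar < deltaGI f M xbar δA) : x ∈ ball xbar r :=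
    ball_subset_ball hδr (mem_ball_of_edist_lt_deltaGI hδ.le hx)
  refine ⟨fun x σ hx hσ hreg => ?_, fun x hx hne => ?_⟩
  · obtain ⟨hnormal, htangent, -⟩ := hball x (hnear x hx)
    exact hreg.elim (hnormal a₁ a₂ σ ha₁ ha₁' ha₂ hσ) (htangent a₁ a₂ δA σ ha₂ ha₂' hσ)
  · exact exists_normalRegion_or_tangentRegion (hball x (hnear x hx)).2.2 hne ha₁ ha₂

theorem mainTheorem3 {d : ℕ} (f : Vec d → ℝ) (M : Set (Vec d)) (xbar : Vec d)
    (φ : LocalDefiningMap 4 M xbar) (γ Ca : ℝ) (hA : MainAssumption f φ γ Ca) :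
    ∃ δ₀ : ℝ, 0 < δ₀ ∧ ∀ δA : ℝ, 0 < δA → δA ≤ δ₀ →
      0 < constD1 f M xbar ∧ 0 < constC2 γ Ca δA ∧ 0 < deltaGI f M xbar δA ∧
      ∀ a₁ a₂ : ℝ, 0 < a₁ → ENNReal.ofReal a₁ ≤ constD1 f M xbar →
        0 < a₂ → a₂ ≤ constC2 γ Ca δA →
        0 < constEta f M xbar γ a₁ a₂ ∧
        (∀ (x : Vec d) (σ : ℝ), edist x xbar < deltaGI f M xbar δA → 0 < σ →
          (NormalRegion M xbar a₁ a₂ x σ ∨ TangentRegion M xbar a₂ x σ) →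
          constEta f M xbar γ a₁ a₂ * ENNReal.ofReal (f x - f xbar) ≤
            ENNReal.ofReal (σ * Metric.infDist 0 (goldsteinSubdiff σ f x))) ∧
        (∀ x : Vec d, edist x xbar < deltaGI f M xbar δA → x ≠ xbar →
          ∃ σ : ℝ, 0 < σ ∧
            (NormalRegion M xbar a₁ a₂ x σ ∨ TangentRegion M xbar a₂ x σ)) := by
  obtain ⟨⟨K, s, hs, hf⟩, o, ho, hb⟩ := And.intro (hA.locallyLipschitz xbar) hA.bRegular
  exact mainTheorem3_general (by norm_num) hA.γ_pos hA.Ca_pos hs hf hA.isLocalMin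
    (mem_nhdsWithin_of_mem_nhds hA.quadraticGrowth) hA.activeManifold hA.strongA
    (isBRegularAlong_of_tendsto ho hb)
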